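/- Let $\mathbb T=\{z\in\mathbb C:|z|=1\}$, let $\alpha\in\mathbb R\setminus\mathbb Q$, put $a=e^{2\pi i\alpha}$, and let $\lambda_a\colon\mathbb T\to\mathbb T$, $\lambda_a(x)=ax$. For a continuous function $t\colon\mathbb T\to\mathbb T$ let $T_{a,t}$ be the homeomorphism $T_{a,t}(x,y)=(ax,t(x)y)$ of $\mathbb T^2$. Systems are homeomorphisms $T$ of compact Hausdorff spaces, viewed as $\mathbb Z$-flows; a homomorphism of systems is a continuous equivariant surjection, its target is called a factor of its source, and a system is equicontinuous if its enveloping semigroup (the pointwise closure of $\{T^n:n\in\mathbb Z\}$) is an equicontinuous family. (i) (Furstenberg, Kodaka) There is a continuous function $t=t_a\colon\mathbb T\to\mathbb T$ such that $(\mathbb T^2,T_{a,t})$ is minimal and distal but not uniquely ergodic. Moreover, $t_a$ can be chosen such that, for some Borel function $g\colon\mathbb T\to\mathbb T$, $g(ax)/g(x)=t_a(x)$ for almost every $x$ (with respect to Haar measure), while for no integer $k\ne0$ does $g^k$ agree almost everywhere with a continuous function $\mathbb T\to\mathbb T$. (ii) For every continuous $t\colon\mathbb T\to\mathbb T$ such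 that $(\mathbb T^2,T_{a,t})$ is minimal and not uniquely ergodic, in particular for every $t_a$ as in (i), the maximal equicontinuous factor of $(\mathbb T^2,T_{a,t})$ is the rotation $(\mathbb T,\lambda_a)$, through the projection $\pi(x,y)=x$. That is, $\pi$ is a homomorphism onto the equicontinuous system $(\mathbb T,\lambda_a)$, and for every homomorphism $\psi$ from $(\mathbb T^2,T_{a,t})$ to an equicontinuous system $(Z,R)$ there is a homomorphism $\theta\colon(\mathbb T,\lambda_a)\to(Z,R)$ with $\psi=\theta\circ\pi$. -/

import Mathlib

open MeasureTheory

universe u v w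

/-! A system is a homeomorphism `T : X ≃ₜ X` of a compact Hausdorff space, regarded as the
`ℤ`-flow `n ↦ T ^ n` (powers are taken in the group of self-homeomorphisms of `X`). -/

/-- The enveloping semigroup (as a set of maps): the closure of `{T ^ n | n ∈ ℤ}` in `X → X` with
the topology of pointwise convergence. -/
def envelopingSemigroup {X : Type u} [TopologicalSpace X] (T : X ≃ₜ X) : Set (X → X) :=
  closure (Set.range fun (n : ℤ) (x : X) => (T ^ n) x)

/-- Minimality: every two-sided orbit is dense. -/
def IsMinimalSystem {X : Type u} [TopologicalSpace X] (T : X ≃ₜ X) : Prop :=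
  ∀ x : X, Dense (Set.range fun n : ℤ => (T ^ n) x)

/-- Distality: there are no non-trivial proximal pairs. -/
def IsDistalSystem {X : Type u} [TopologicalSpace X] (T : X ≃ₜ X) : Prop :=
  ∀ x x' : X, (∃ p ∈ envelopingSemigroup T, p x = p x') → x = x'

/-- Equicontinuity of the enveloping semigroup. The uniformity of a compact Hausdorff space is
determined by its topology. -/
def IsEquicontinuousSystem {X : Type u} [UniformSpace X] (T : X ≃ₜ X) : Prop :=
  (envelopingSemigroup T).Equicontinuous

/-- The regular Borel probability measures that are invariant under `T`. -/
def invariantMeasures {X : Type u} [TopologicalSpace X] [MeasurableSpace X] (T : X ≃ₜ X) :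
    Set (Measure X) :=
  {μ | IsProbabilityMeasure μ ∧ μ.Regular ∧ MeasurePreserving T μ μ}

/-- Unique ergodicity: there is exactly one invariant measure. -/
def IsUniquelyErgodic {X : Type u} [TopologicalSpace X] [MeasurableSpace X] (T : X ≃ₜ X) : Prop :=
  ∃! μ : Measure X, μ ∈ invariantMeasures T

/-- `π` is a homomorphism of systems, exhibiting `(Y, S)` as a factor of `(X, T)`. -/
structure IsFactorMap {X : Type u} {Y : Type v} [TopologicalSpace X] [TopologicalSpace Y]
    (T : X ≃ₜ X) (S : Y ≃ₜ Y) (π : X → Y) : Prop where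
  continuous : Continuous π
  surjective : Function.Surjective π
  equivariant : ∀ x, π (T x) = S (π x)

/-- `(Y, S)` is, through the homomorphism `π`, the maximal equicontinuous factor of `(X, T)`:
it is an equicontinuous factor, and each equicontinuous factor `(Z, R)` of `(X, T)` is a factor of
`(Y, S)`, compatibly with the homomorphisms from `X`. -/
structure IsMaximalEquicontinuousFactor {X : Type u} {Y : Type v} [UniformSpace X] [UniformSpace Y]
    (T : X ≃ₜ X) (S : Y ≃ₜ Y) (π : X → Y) : Prop where
  isFactorMap : IsFactorMap T S π
  equicontinuous : IsEquicontinuousSystem S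
  maximal : ∀ (Z : Type w) [UniformSpace Z] [CompactSpace Z] [T2Space Z] (R : Z ≃ₜ Z) (ψ : X → Z),
    IsFactorMap T R ψ → IsEquicontinuousSystem R →
      ∃ θ : Y → Z, IsFactorMap S R θ ∧ ∀ x, θ (π x) = ψ x

/-- The circle carries its Borel σ-algebra. -/
noncomputable instance Circle.borelMeasurableSpace : MeasurableSpace Circle := borel Circle

instance Circle.borelSpaceInst : BorelSpace Circle := ⟨rfl⟩

/-- The rotation `x ↦ a x` of the circle. -/
noncomputable def circleRotation (a : Circle) : Circle ≃ₜ Circle := Homeomorph.mulLeft a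

/-- The skew product `(x, y) ↦ (a x, t(x) y)` on the 2-torus. -/
noncomputable def skewProduct (a : Circle) (t : C(Circle, Circle)) : Circle × Circle ≃ₜ Circle × Circle where
  toFun p := (a * p.1, t p.1 * p.2)
  invFun p := (a⁻¹ * p.1, (t (a⁻¹ * p.1))⁻¹ * p.2)
  left_inv p := by simp
  right_inv p := by simp
  continuous_toFun := by fun_prop
  continuous_invFun := by fun_prop

/-- The property of the cocycles of the Furstenberg–Kodaka construction: `t(x) = g(ax) / g(x)` for
almost every `x`, with `g` Borel and no power `g ^ k`, `k ≠ 0`, almost everywhere equal to a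
continuous function. -/
def IsKodakaCocycle (a : Circle) (t : C(Circle, Circle)) : Prop :=
  ∃ g : Circle → Circle, Measurable g ∧
    (∀ᵐ x ∂(Measure.haar : Measure Circle), g (a * x) / g x = t x) ∧
    ∀ k : ℤ, k ≠ 0 → ∀ f : C(Circle, Circle),
      ¬ ∀ᵐ x ∂(Measure.haar : Measure Circle), g x ^ k = f x

/-! Write t_n for the cocycle of the n-th iterate (`skewCocycle`). (ii) Suppose a homomorphism ψ to
an equicontinuous system separates two points of one fibre of the projection. By minimality, a fibre
rotation that preserves ψ at one point preserves it everywhere, and such rotations form a proper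
closed subgroup of the circle, of some finite exponent l. Equicontinuity of the target then makes
the family t_n^l equicontinuous (`exists_equicontinuous_skewCocycle_pow`). On the other hand, an
invariant measure other than Haar measure has fibre measures whose k-th Fourier coefficient φ, for
some k ≠ 0, is not almost everywhere zero; invariance gives φ(a^n x) = t_n(x)^k φ(x)
(`exists_measurable_eigenfunction`). These facts collide in `not_equicontinuous_skewCocycle_pow`.
Minimality gives n_i with a^{n_i} → 1 and t_{n_i}(1) → ζ, where ζ^{lk} = -1. Equicontinuity spreads
this from the dense orbit of 1, so t_{n_i}^{lk} → -1 pointwise. Hence φ^l(a^{n_i} x) → -φ^l(x),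
whereas rotations tending to the identity preserve Fourier coefficients in the limit. All
coefficients of φ^l vanish, so φ = 0 almost everywhere. (i) Take nonnegative continuous spikes G_i
with summable means and increments G_i(ax) - G_i(x) at most 2^{-i} in size
(`exists_almost_invariant_spikes`). The increments sum to a continuous h, and ∑ G_i is finite almost
everywhere; t = exp(ih) is then a coboundary with transfer function g = exp(i ∑ G_i). Along times
N_l with a^{N_l} → 1 the sums of h over the orbit of 1 tend to -1, so no nonzero power of t is a
continuous coboundary. This gives minimality (`isMinimalSystem_skewProduct`), while the graphs of g
and -g carry distinct invariant measures. -/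

open Filter Topology
open scoped BoundedContinuousFunction

/-! ### Powers, roots and closed subgroups in the circle -/

section CircleFacts

/-- The powers of `exp (2πiα)`, `α` irrational, are dense in the circle. -/
theorem Circle.denseRange_zpow_of_irrational {α : ℝ} (hα : Irrational α) :
    DenseRange (fun n : ℤ => Circle.exp (2 * Real.pi * α) ^ n) := by
  have h : DenseRange (fun n : ℤ => n • (α : AddCircle (1 : ℝ))) :=
    AddCircle.denseRange_zsmul_coe_iff.2 (by simpa using hα)
  have hs : DenseRange (AddCircle.toCircle : AddCircle (1 : ℝ) → Circle) := by
    have : Function.Surjective (AddCircle.homeomorphCircle (one_ne_zero : (1 : ℝ) ≠ 0)) :=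
      Homeomorph.surjective _
    refine Function.Surjective.denseRange fun y => ?_
    obtain ⟨x, hx⟩ := this y
    exact ⟨x, by rwa [AddCircle.homeomorphCircle_apply] at hx⟩
  have := hs.comp h AddCircle.continuous_toCircle
  convert this using 2 with n
  simp [AddCircle.toCircle_zsmul, AddCircle.toCircle_apply_mk]

/-- A proper closed subgroup of the circle has finite exponent. -/
theorem Circle.exists_pow_eq_one_of_isClosed {H : Subgroup Circle} (hc : IsClosed (H : Set Circle))
    (hH : H ≠ ⊤) : ∃ k : ℕ, k ≠ 0 ∧ ∀ c ∈ H, c ^ k = 1 := by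
  let e := AddCircle.homeomorphCircle (one_ne_zero : (1 : ℝ) ≠ 0)
  have he : ∀ x, e x = AddCircle.toCircle x := AddCircle.homeomorphCircle_apply _
  let s : AddSubgroup (AddCircle (1 : ℝ)) :=
    { carrier := {x | AddCircle.toCircle x ∈ H}
      add_mem' := fun {x y} hx hy => by
        simpa [AddCircle.toCircle_add] using H.mul_mem hx hy
      zero_mem' := by simp
      neg_mem' := fun {x} hx => by simpa [AddCircle.toCircle_neg] using hx }
  have hs : ¬ Dense (s : Set (AddCircle (1 : ℝ))) := by
    intro hd
    apply hH
    have hcl : IsClosed (s : Set (AddCircle (1 : ℝ))) := hc.preimage AddCircle.continuous_toCircle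
    have huniv : (s : Set (AddCircle (1 : ℝ))) = Set.univ := by
      rw [← hcl.closure_eq, hd.closure_eq]
    rw [eq_top_iff]
    intro y _
    obtain ⟨x, rfl⟩ := e.surjective y
    have : x ∈ (s : Set (AddCircle (1 : ℝ))) := by rw [huniv]; trivial
    rw [he]
    exact this
  -- A subgroup that is not dense is generated by an element of finite order; that order is the
  -- exponent.
  rw [AddCircle.dense_addSubgroup_iff_ne_zmultiples] at hs
  push Not at hs
  obtain ⟨b, hb, hsb⟩ := hs
  refine ⟨addOrderOf b, hb, fun c hcH => ?_⟩
  obtain ⟨x, rfl⟩ := e.surjective c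
  rw [he] at hcH ⊢
  have hx : x ∈ s := hcH
  rw [hsb, AddSubgroup.mem_zmultiples_iff] at hx
  obtain ⟨n, rfl⟩ := hx
  rw [← AddCircle.toCircle_nsmul, smul_comm, addOrderOf_nsmul_eq_zero]
  simp

theorem Circle.exists_zpow_eq (w : Circle) {n : ℤ} (hn : n ≠ 0) : ∃ z : Circle, z ^ n = w := by
  refine ⟨Circle.exp (Complex.arg w / n), ?_⟩
  rw [← Circle.exp_zsmul, zsmul_eq_mul, mul_div_cancel₀ _ (by exact_mod_cast hn), Circle.exp_arg]

theorem Circle.neg_one_ne_one : (-1 : Circle) ≠ 1 := by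
  intro h
  have := congrArg (fun z : Circle => (z : ℂ)) h
  norm_num at this

/-- Otherwise `z ^ i = 1` would extend from the dense powers of `a` to every `z`, although `-1` is
an `i`-th power. -/
theorem Circle.zpow_ne_one_of_denseRange {a : Circle} (ha : DenseRange (fun n : ℤ => a ^ n)) {i : ℤ}
    (hi : i ≠ 0) : a ^ i ≠ 1 := by
  intro h
  have hcl : IsClosed {z : Circle | z ^ i = 1} :=
    isClosed_eq (continuous_id.zpow i) continuous_const
  obtain ⟨z, hz⟩ := Circle.exists_zpow_eq (-1) hi
  have : z ^ i = 1 := ha.induction_on (p := fun z : Circle => z ^ i = 1) z hcl fun n => by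
    rw [zpow_comm, h, one_zpow]
  exact Circle.neg_one_ne_one (hz.symm.trans this)

end CircleFacts

/-! ### Fourier coefficients of measures and functions on the circle and the torus -/

section Measures

/-- Finite Borel measures on a Polish space agree if they integrate the members of a separating
multiplicative star-closed family of bounded continuous functions in the same way. -/
theorem MeasureTheory.Measure.ext_of_integral_eq_of_mul_closed {K : Type*} [TopologicalSpace K]
    [PolishSpace K] [MeasurableSpace K] [BorelSpace K] (μ ν : Measure K) [IsFiniteMeasure μ]
    [IsFiniteMeasure ν] (S : Submonoid (K →ᵇ ℂ)) (hstar : ∀ f ∈ S, star f ∈ S)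
    (hsep : ∀ x y : K, x ≠ y → ∃ f ∈ S, f x ≠ f y)
    (h : ∀ f ∈ S, ∫ x, f x ∂μ = ∫ x, f x ∂ν) : μ = ν := by
  -- As `S` is closed under products, the algebra it generates is its linear span, so equality of
  -- integrals extends by linearity alone.
  have hspan : ∀ f, f ∈ Algebra.adjoin ℂ (S : Set (K →ᵇ ℂ)) ↔
      f ∈ Submodule.span ℂ (S : Set (K →ᵇ ℂ)) := fun f => by
    rw [← Subalgebra.mem_toSubmodule, Algebra.adjoin_eq_span, Submonoid.closure_eq]
  let A : StarSubalgebra ℂ (K →ᵇ ℂ) :=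
    { Algebra.adjoin ℂ (S : Set (K →ᵇ ℂ)) with
      star_mem' := by
        intro f hf
        change f ∈ Algebra.adjoin ℂ (S : Set (K →ᵇ ℂ)) at hf
        change star f ∈ Algebra.adjoin ℂ (S : Set (K →ᵇ ℂ))
        rw [hspan] at hf ⊢
        induction hf using Submodule.span_induction with
        | mem x hx => exact Submodule.subset_span (hstar x hx)
        | zero => simp
        | add x y _ _ hx hy => rw [star_add]; exact Submodule.add_mem _ hx hy
        | smul c x _ hx => rw [star_smul]; exact Submodule.smul_mem _ _ hx }
  have hA : ∀ f, f ∈ A ↔ f ∈ Submodule.span ℂ (S : Set (K →ᵇ ℂ)) := hspan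
  refine ext_of_forall_mem_subalgebra_integral_eq_of_polish (𝕜 := ℂ) (A := A) ?_ ?_
  · intro x y hxy
    obtain ⟨f, hf, hne⟩ := hsep x y hxy
    refine ⟨f, ⟨f.toContinuousMap, ?_, rfl⟩, hne⟩
    exact ⟨f, (hA f).2 (Submodule.subset_span hf), rfl⟩
  · intro f hf
    rw [hA] at hf
    induction hf using Submodule.span_induction with
    | mem x hx => exact h x hx
    | zero => simp
    | add x y _ _ hx hy =>
      simp only [BoundedContinuousFunction.coe_add, Pi.add_apply]
      rw [integral_add (x.integrable μ) (y.integrable μ),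
        integral_add (x.integrable ν) (y.integrable ν), hx, hy]
    | smul c x _ hx =>
      simp only [BoundedContinuousFunction.coe_smul]
      rw [integral_smul, integral_smul, hx]

/-- The Haar probability measure of the circle. -/
noncomputable def circleHaar : Measure Circle := Measure.haarMeasure ⊤

instance : circleHaar.IsHaarMeasure := by unfold circleHaar; infer_instance

instance : IsProbabilityMeasure circleHaar := ⟨by
  have := Measure.haarMeasure_self (G := Circle) (K₀ := ⊤)
  simpa [circleHaar] using this⟩

/-- The two Haar measures differ by a nonzero factor, so they have the same null sets. -/
theorem ae_haar_iff_ae_circleHaar {p : Circle → Prop} :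
    (∀ᵐ x ∂(Measure.haar : Measure Circle), p x) ↔ ∀ᵐ x ∂circleHaar, p x := by
  have h := Measure.haarMeasure_unique (Measure.haar : Measure Circle) ⊤
  change _ = _ • circleHaar at h
  rw [h, Measure.ae_ennreal_smul_measure_iff]
  simpa using (inferInstance : NeZero (Measure.haar : Measure Circle)).ne

theorem MeasureTheory.Measure.ext_of_integral_zpow {μ ν : Measure Circle} [IsFiniteMeasure μ]
    [IsFiniteMeasure ν]
    (h : ∀ i : ℤ, ∫ x, ((x ^ i : Circle) : ℂ) ∂μ = ∫ x, ((x ^ i : Circle) : ℂ) ∂ν) : μ = ν := by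
  let S : Submonoid (Circle →ᵇ ℂ) :=
    { carrier := {f | ∃ i : ℤ, ∀ x : Circle, f x = ((x ^ i : Circle) : ℂ)}
      one_mem' := ⟨0, fun x => by simp⟩
      mul_mem' := by
        rintro f g ⟨i, hi⟩ ⟨j, hj⟩
        exact ⟨i + j, fun x => by simp [hi, hj, zpow_add]⟩ }
  refine Measure.ext_of_integral_eq_of_mul_closed μ ν S ?_ ?_ ?_
  · rintro f ⟨i, hi⟩
    exact ⟨-i, fun x => by
      rw [BoundedContinuousFunction.star_apply, hi, zpow_neg, Circle.coe_inv_eq_conj]; rfl⟩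
  · intro x y hxy
    refine ⟨BoundedContinuousFunction.mkOfCompact ⟨fun x : Circle => (x : ℂ), by fun_prop⟩,
      ⟨1, fun x => by rw [zpow_one]; rfl⟩, fun h => hxy (Circle.ext h)⟩
  · rintro f ⟨i, hi⟩
    simpa only [hi] using h i

theorem MeasureTheory.Measure.ext_of_integral_zpow_mul_zpow {μ ν : Measure (Circle × Circle)}
    [IsFiniteMeasure μ] [IsFiniteMeasure ν]
    (h : ∀ i j : ℤ, ∫ p, ((p.1 ^ i * p.2 ^ j : Circle) : ℂ) ∂μ =
      ∫ p, ((p.1 ^ i * p.2 ^ j : Circle) : ℂ) ∂ν) : μ = ν := by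
  let S : Submonoid (Circle × Circle →ᵇ ℂ) :=
    { carrier := {f | ∃ i j : ℤ, ∀ p : Circle × Circle, f p = ((p.1 ^ i * p.2 ^ j : Circle) : ℂ)}
      one_mem' := ⟨0, 0, fun x => by simp⟩
      mul_mem' := by
        rintro f g ⟨i, j, hi⟩ ⟨i', j', hj⟩
        refine ⟨i + i', j + j', fun x => ?_⟩
        rw [BoundedContinuousFunction.mul_apply, hi, hj, ← Circle.coe_mul, zpow_add, zpow_add,
          mul_mul_mul_comm] }
  refine Measure.ext_of_integral_eq_of_mul_closed μ ν S ?_ ?_ ?_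
  · rintro f ⟨i, j, hi⟩
    refine ⟨-i, -j, fun x => ?_⟩
    rw [BoundedContinuousFunction.star_apply, hi, zpow_neg, zpow_neg, ← mul_inv,
      Circle.coe_inv_eq_conj]
    rfl
  · intro x y hxy
    by_cases h1 : x.1 = y.1
    · refine ⟨BoundedContinuousFunction.mkOfCompact
        ⟨fun p : Circle × Circle => (p.2 : ℂ), by fun_prop⟩, ⟨0, 1, fun x => ?_⟩,
        fun h2 => hxy (Prod.ext h1 (Circle.ext h2))⟩
      rw [zpow_zero, one_mul, zpow_one]
      rfl
    · refine ⟨BoundedContinuousFunction.mkOfCompact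
        ⟨fun p : Circle × Circle => (p.1 : ℂ), by fun_prop⟩, ⟨1, 0, fun x => ?_⟩,
        fun h2 => h1 (Circle.ext h2)⟩
      rw [zpow_zero, mul_one, zpow_one]
      rfl
  · rintro f ⟨i, j, hi⟩
    simpa only [hi] using h i j

theorem integral_zpow_eq_zero {a : Circle} {ν : Measure Circle}
    (hν : MeasurePreserving (fun x => a * x) ν ν) {i : ℤ} (hi : a ^ i ≠ 1) :
    ∫ x, ((x ^ i : Circle) : ℂ) ∂ν = 0 := by
  have h1 : ∫ x, (((a * x) ^ i : Circle) : ℂ) ∂ν = ∫ x, ((x ^ i : Circle) : ℂ) ∂ν :=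
    hν.integral_comp (Homeomorph.mulLeft a).measurableEmbedding (fun x => ((x ^ i : Circle) : ℂ))
  simp only [mul_zpow, Circle.coe_mul] at h1
  rw [integral_const_mul] at h1
  have h2 : (((a ^ i : Circle) : ℂ) - 1) * ∫ x, ((x ^ i : Circle) : ℂ) ∂ν = 0 := by
    rw [sub_mul, h1, one_mul, sub_self]
  refine (mul_eq_zero.1 h2).resolve_left fun h => hi ?_
  rw [Circle.ext_iff, Circle.coe_one]
  exact sub_eq_zero.1 h

/-- Unique ergodicity of an irrational rotation. -/
theorem eq_circleHaar_of_measurePreserving {a : Circle} (ha : DenseRange (fun n : ℤ => a ^ n))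
    {ν : Measure Circle} [IsProbabilityMeasure ν] (hν : MeasurePreserving (fun x => a * x) ν ν) :
    ν = circleHaar := by
  refine Measure.ext_of_integral_zpow fun i => ?_
  by_cases hi : i = 0
  · simp [hi]
  · have hi' := Circle.zpow_ne_one_of_denseRange ha hi
    rw [integral_zpow_eq_zero hν hi', integral_zpow_eq_zero (measurePreserving_mul_left _ a) hi']

/-- The image measure is invariant under one irrational rotation (here by `√2`), and unique
ergodicity identifies it. This transports the completeness of Fourier series from `AddCircle`. -/
theorem map_toCircle_haarAddCircle :
    Measure.map (AddCircle.toCircle : AddCircle (1 : ℝ) → Circle) AddCircle.haarAddCircle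
      = circleHaar := by
  have hm : Measurable (AddCircle.toCircle : AddCircle (1 : ℝ) → Circle) :=
    AddCircle.continuous_toCircle.measurable
  have : IsProbabilityMeasure (Measure.map (AddCircle.toCircle : AddCircle (1 : ℝ) → Circle)
      AddCircle.haarAddCircle) := Measure.isProbabilityMeasure_map hm.aemeasurable
  refine eq_circleHaar_of_measurePreserving
    (Circle.denseRange_zpow_of_irrational irrational_sqrt_two) ⟨by fun_prop, ?_⟩
  rw [Measure.map_map (by fun_prop) hm]
  have hc : (fun x => Circle.exp (2 * Real.pi * √2) * x) ∘
      (AddCircle.toCircle : AddCircle (1 : ℝ) → Circle) =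
      AddCircle.toCircle ∘ fun x => ((√2 : ℝ) : AddCircle (1 : ℝ)) + x := by
    funext x
    simp [AddCircle.toCircle_add, AddCircle.toCircle_apply_mk]
  rw [hc, ← Measure.map_map hm (by fun_prop), map_add_left_eq_self]

/-- A bounded measurable function on the circle all of whose Fourier coefficients vanish is zero
almost everywhere. -/
theorem ae_eq_zero_of_integral_mul_zpow_eq_zero {f : Circle → ℂ} (hf : Measurable f) {C : ℝ}
    (hC : ∀ x, ‖f x‖ ≤ C) (h : ∀ j : ℤ, ∫ x, f x * ((x ^ j : Circle) : ℂ) ∂circleHaar = 0) :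
    ∀ᵐ x ∂circleHaar, f x = 0 := by
  have hm : Measurable (AddCircle.toCircle : AddCircle (1 : ℝ) → Circle) :=
    AddCircle.continuous_toCircle.measurable
  have hF : MemLp (fun x : AddCircle (1 : ℝ) => f (AddCircle.toCircle x)) 2
      AddCircle.haarAddCircle :=
    MemLp.of_bound (hf.comp hm).aestronglyMeasurable C (ae_of_all _ fun x => hC _)
  have hs := hasSum_fourier_series_L2 hF.toLp
  have hcoef : ∀ n : ℤ, fourierCoeff (hF.toLp : AddCircle (1 : ℝ) → ℂ) n = 0 := by
    intro n
    rw [fourierCoeff_congr_ae hF.coeFn_toLp, fourierCoeff]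
    rw [← h (-n), ← map_toCircle_haarAddCircle, integral_map hm.aemeasurable]
    · refine integral_congr_ae (ae_of_all _ fun x => ?_)
      simp only [fourier_apply, smul_eq_mul, AddCircle.toCircle_zsmul]
      rw [mul_comm]
    · exact (hf.mul (by fun_prop)).aestronglyMeasurable
  simp only [hcoef, zero_smul] at hs
  have h0 : hF.toLp = 0 := hs.unique hasSum_zero
  have hae := hF.coeFn_toLp
  rw [h0] at hae
  have hset : MeasurableSet {x | f x = 0} := hf (measurableSet_singleton 0)
  rw [← map_toCircle_haarAddCircle, ae_map_iff hm.aemeasurable hset]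
  filter_upwards [hae, Lp.coeFn_zero ℂ 2 (AddCircle.haarAddCircle (T := 1))] with x h1 h2
  rw [← h1, h2]
  rfl

end Measures

/-! ### Iterates, and minimal sets via Zorn's lemma -/

section Dynamics

theorem Homeomorph.semiconj_zpow {X Y : Type*} [TopologicalSpace X] [TopologicalSpace Y]
    {T : X ≃ₜ X} {S : Y ≃ₜ Y} {π : X → Y} (h : ∀ x, π (T x) = S (π x)) (n : ℤ) (x : X) :
    π ((T ^ n) x) = (S ^ n) (π x) := by
  have hn : ∀ (n : ℕ) x, π ((T ^ n) x) = (S ^ n) (π x) := by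
    intro n
    induction n with
    | zero => intro x; rfl
    | succ n ih =>
      intro x
      rw [pow_succ, pow_succ]
      change π ((T ^ n) (T x)) = (S ^ n) (S (π x))
      rw [ih, h]
  obtain ⟨n, rfl | rfl⟩ := n.eq_nat_or_neg
  · simpa using hn n x
  · have h1 : (T ^ n) ((T ^ (-(n : ℤ))) x) = x := by
      change (T ^ n * T ^ (-(n : ℤ))) x = x
      simp
    have h2 : (S ^ (-(n : ℤ))) ((S ^ n) (π ((T ^ (-(n : ℤ))) x))) = π ((T ^ (-(n : ℤ))) x) := by
      change (S ^ (-(n : ℤ)) * S ^ n) _ = _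
      simp
    rw [← h2, ← hn, h1]

theorem Homeomorph.zpow_add_apply {X : Type*} [TopologicalSpace X] (T : X ≃ₜ X) (m n : ℤ) (x : X) :
    (T ^ (m + n)) x = (T ^ m) ((T ^ n) x) := by
  rw [zpow_add]; rfl

theorem IsMinimalSystem.eq_univ {X : Type*} [TopologicalSpace X] {T : X ≃ₜ X}
    (hT : IsMinimalSystem T) {s : Set X} (hs : IsClosed s) (hinv : ∀ x ∈ s, ∀ n : ℤ, (T ^ n) x ∈ s)
    (hne : s.Nonempty) : s = Set.univ := by
  obtain ⟨x, hx⟩ := hne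
  have : Set.range (fun n : ℤ => (T ^ n) x) ⊆ s := by
    rintro _ ⟨n, rfl⟩
    exact hinv x hx n
  exact Set.eq_univ_of_univ_subset ((hT x).closure_eq ▸ hs.closure_subset_iff.2 this)

/-- A system that is not minimal has a proper minimal closed invariant subset. -/
theorem exists_minimal_closed_invariant {X : Type*} [TopologicalSpace X] [CompactSpace X]
    {T : X ≃ₜ X} (hT : ¬ IsMinimalSystem T) :
    ∃ M : Set X, Minimal (fun s : Set X => IsClosed s ∧ s.Nonempty ∧
      ∀ x ∈ s, ∀ n : ℤ, (T ^ n) x ∈ s) M ∧ M ≠ Set.univ := by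
  obtain ⟨x, hx⟩ : ∃ x, ¬ Dense (Set.range fun n : ℤ => (T ^ n) x) := by
    simpa [IsMinimalSystem] using hT
  let C := closure (Set.range fun n : ℤ => (T ^ n) x)
  have hC : C ∈ {s : Set X | IsClosed s ∧ s.Nonempty ∧ ∀ x ∈ s, ∀ n : ℤ, (T ^ n) x ∈ s} := by
    refine ⟨isClosed_closure, (Set.range_nonempty _).closure, fun y hy n => ?_⟩
    refine map_mem_closure (T ^ n).continuous hy ?_
    rintro _ ⟨m, rfl⟩
    exact ⟨n + m, T.zpow_add_apply n m x⟩
  obtain ⟨M, hMC, hM⟩ := zorn_superset_nonempty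
    {s : Set X | IsClosed s ∧ s.Nonempty ∧ ∀ x ∈ s, ∀ n : ℤ, (T ^ n) x ∈ s} (by
      intro c hc hchain hne
      refine ⟨⋂₀ c, ⟨isClosed_sInter fun s hs => (hc hs).1, ?_, ?_⟩,
        fun s hs => Set.sInter_subset_of_mem hs⟩
      · have : Nonempty c := hne.to_subtype
        rw [Set.sInter_eq_iInter]
        refine IsCompact.nonempty_iInter_of_directed_nonempty_isCompact_isClosed _ ?_
          (fun s => (hc s.2).2.1) (fun s => (hc s.2).1.isCompact) (fun s => (hc s.2).1)
        rintro ⟨s, hs⟩ ⟨s', hs'⟩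
        rcases hchain.total hs hs' with h | h
        · exact ⟨⟨s, hs⟩, subset_rfl, h⟩
        · exact ⟨⟨s', hs'⟩, h, subset_rfl⟩
      · intro y hy n s hs
        exact (hc hs).2.2 y (hy s hs) n) C hC
  refine ⟨M, hM, fun h => hx ?_⟩
  rw [dense_iff_closure_eq]
  exact Set.eq_univ_of_univ_subset (h ▸ hMC)

end Dynamics

/-! ### Skew products: cocycle, distality, minimality criterion -/

section SkewProduct

variable {a : Circle} {t : C(Circle, Circle)}

theorem circleRotation_zpow_apply (a : Circle) (n : ℤ) (x : Circle) :
    (circleRotation a ^ n) x = a ^ n * x := by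
  induction n using Int.induction_on with
  | zero => simp
  | succ n ih =>
    rw [add_comm, Homeomorph.zpow_add_apply, ih, zpow_add, mul_assoc]
    simp [circleRotation]
  | pred n ih =>
    rw [sub_eq_add_neg, add_comm, Homeomorph.zpow_add_apply, ih, zpow_add, mul_assoc]
    simp only [zpow_neg_one]
    rfl

/-- The cocycle of the iterates of the skew product:
`(skewProduct a t) ^ n` maps `(x, y)` to `(a ^ n * x, skewCocycle a t n x * y)`. -/
noncomputable def skewCocycle (a : Circle) (t : C(Circle, Circle)) (n : ℤ) (x : Circle) : Circle :=
  ((skewProduct a t ^ n) (x, 1)).2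

/-- The skew product commutes with rotations of the second coordinate, so its iterates are
determined by their values at `(x, 1)`. -/
theorem skewProduct_zpow_apply (n : ℤ) (p : Circle × Circle) :
    (skewProduct a t ^ n) p = (a ^ n * p.1, skewCocycle a t n p.1 * p.2) := by
  refine Prod.ext ?_ ?_
  · rw [Homeomorph.semiconj_zpow (S := circleRotation a) (π := Prod.fst) (fun _ => rfl),
      circleRotation_zpow_apply]
  · have h := Homeomorph.semiconj_zpow (T := skewProduct a t) (S := skewProduct a t)
      (π := fun q : Circle × Circle => (q.1, q.2 * p.2))
      (fun q => by simp [skewProduct, mul_assoc]) n (p.1, 1)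
    simp only [one_mul] at h
    have h2 := congrArg Prod.snd h
    exact h2.symm

theorem continuous_skewCocycle (n : ℤ) : Continuous (skewCocycle a t n) :=
  (((skewProduct a t ^ n).continuous).comp (by fun_prop : Continuous fun x : Circle =>
    (x, (1 : Circle)))).snd

theorem skewCocycle_one (x : Circle) : skewCocycle a t 1 x = t x := by
  simp [skewCocycle, skewProduct]

theorem skewCocycle_add (m n : ℤ) (x : Circle) :
    skewCocycle a t (m + n) x = skewCocycle a t m (a ^ n * x) * skewCocycle a t n x := by
  have h := (skewProduct a t).zpow_add_apply m n (x, 1)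
  simp only [skewProduct_zpow_apply, mul_one] at h
  exact congrArg Prod.snd h

/-- All iterates preserve the ratio of first coordinates and, within a fibre, that of second
coordinates. Both relations pass to pointwise limits, so a collapsed pair was already equal. -/
theorem isDistalSystem_skewProduct (a : Circle) (t : C(Circle, Circle)) :
    IsDistalSystem (skewProduct a t) := by
  rintro ⟨u, v⟩ ⟨u', v'⟩ ⟨p, hp, hpp⟩
  have h1 : ∀ q ∈ envelopingSemigroup (skewProduct a t),
      (q (u, v)).1 * u' = (q (u', v')).1 * u := by
    intro q hq
    refine closure_minimal (s := Set.range _)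
      (t := {q : Circle × Circle → Circle × Circle | (q (u, v)).1 * u' = (q (u', v')).1 * u})
      ?_ (isClosed_eq (by fun_prop) (by fun_prop)) hq
    rintro _ ⟨n, rfl⟩
    simp only [Set.mem_ofPred_eq, skewProduct_zpow_apply]
    rw [mul_assoc, mul_assoc, mul_comm u u']
  have hu : u = u' := by
    have := h1 p hp
    rw [hpp] at this
    exact (mul_left_cancel this).symm
  subst hu
  have h2 : ∀ q ∈ envelopingSemigroup (skewProduct a t),
      (q (u, v)).2 * v' = (q (u, v')).2 * v := by
    intro q hq
    refine closure_minimal (s := Set.range _)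
      (t := {q : Circle × Circle → Circle × Circle | (q (u, v)).2 * v' = (q (u, v')).2 * v})
      ?_ (isClosed_eq (by fun_prop) (by fun_prop)) hq
    rintro _ ⟨n, rfl⟩
    simp only [Set.mem_ofPred_eq, skewProduct_zpow_apply]
    rw [mul_assoc, mul_assoc, mul_comm v v']
  have := h2 p hp
  rw [hpp] at this
  rw [mul_left_cancel this]

theorem measurePreserving_skewProduct_prod (a : Circle) (t : C(Circle, Circle)) :
    MeasurePreserving (skewProduct a t) (circleHaar.prod circleHaar)
      (circleHaar.prod circleHaar) :=
  MeasurePreserving.skew_product (f := fun x => a * x) (g := fun x y => t x * y)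
    (measurePreserving_mul_left _ a) (by fun_prop)
    (ae_of_all _ fun x => map_mul_left_eq_self _ _)

theorem MeasureTheory.MeasurePreserving.homeomorph_zpow {X : Type*} [TopologicalSpace X]
    [MeasurableSpace X] [BorelSpace X] {T : X ≃ₜ X} {μ : Measure X} (h : MeasurePreserving T μ μ)
    (n : ℤ) : MeasurePreserving (T ^ n : X ≃ₜ X) μ μ := by
  have h' : MeasurePreserving (T⁻¹ : X ≃ₜ X) μ μ :=
    MeasurePreserving.symm T.toMeasurableEquiv h
  induction n using Int.induction_on with
  | zero => exact MeasurePreserving.id μ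
  | succ n ih =>
    rw [zpow_add, zpow_one]
    exact ih.comp h
  | pred n ih =>
    rw [sub_eq_add_neg, zpow_add, zpow_neg_one]
    exact ih.comp h'

/-- If no nonzero power of `t` is a continuous coboundary, then the skew product is minimal. -/
theorem isMinimalSystem_skewProduct (ha : DenseRange (fun n : ℤ => a ^ n))
    (ht : ∀ k : ℤ, k ≠ 0 → ∀ f : C(Circle, Circle), ¬ ∀ x, f (a * x) = t x ^ k * f x) :
    IsMinimalSystem (skewProduct a t) := by
  by_contra hT
  obtain ⟨M, hM, hMu⟩ := exists_minimal_closed_invariant hT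
  have hMc : IsClosed M := hM.prop.1
  have hMi : ∀ x ∈ M, ∀ n : ℤ, (skewProduct a t ^ n) x ∈ M := hM.prop.2.2
  -- The part of `M` that the fibre rotation by `c` sends into `M` is closed and invariant; once
  -- nonempty, it is all of `M`.
  have hinter : ∀ c : Circle, ∀ x y, (x, y) ∈ M → (x, c * y) ∈ M →
      ∀ p ∈ M, (p.1, c * p.2) ∈ M := by
    intro c x y h1 h2 p hp
    have hle : M ≤ M ∩ {p : Circle × Circle | (p.1, c * p.2) ∈ M} := by
      refine hM.le_of_le ⟨hMc.inter (hMc.preimage (by fun_prop)), ⟨(x, y), h1, h2⟩, ?_⟩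
        Set.inter_subset_left
      rintro q ⟨hq, hq'⟩ n
      refine ⟨hMi q hq n, ?_⟩
      have := hMi _ hq' n
      rw [skewProduct_zpow_apply] at this ⊢
      rwa [Set.mem_ofPred_eq, mul_left_comm]
    exact (hle hp).2
  have hfst : ∀ x, ∃ y, (x, y) ∈ M := by
    obtain ⟨⟨x₀, y₀⟩, h₀⟩ := hM.prop.2.1
    have hcl : IsClosed (Prod.fst '' M) := (hMc.isCompact.image continuous_fst).isClosed
    have hd : Dense (Prod.fst '' M) := by
      have hd' : DenseRange fun n : ℤ => a ^ n * x₀ :=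
        (Group.mulRight_bijective x₀).surjective.denseRange.comp ha (by fun_prop)
      refine hd'.mono ?_
      rintro _ ⟨n, rfl⟩
      refine ⟨_, hMi _ h₀ n, ?_⟩
      rw [skewProduct_zpow_apply]
    intro x
    have : x ∈ Prod.fst '' M := by
      rw [← hcl.closure_eq, hd.closure_eq]; trivial
    obtain ⟨⟨_, y⟩, hy, rfl⟩ := this
    exact ⟨y, hy⟩
  have hmem_inv : ∀ c : Circle, (∀ p ∈ M, (p.1, c * p.2) ∈ M) →
      ∀ p ∈ M, (p.1, c⁻¹ * p.2) ∈ M := by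
    intro c hc p hp
    have hle : M ≤ (fun p : Circle × Circle => (p.1, c * p.2)) '' M := by
      refine hM.le_of_le ⟨(hMc.isCompact.image (by fun_prop)).isClosed, hM.prop.2.1.image _, ?_⟩ ?_
      · rintro _ ⟨q, hq, rfl⟩ n
        refine ⟨_, hMi q hq n, ?_⟩
        simp only [skewProduct_zpow_apply, mul_left_comm]
      · rintro _ ⟨q, hq, rfl⟩
        exact hc q hq
    obtain ⟨q, hq, rfl⟩ := hle hp
    simpa using hq
  let H : Subgroup Circle :=
    { carrier := {c | ∀ p ∈ M, (p.1, c * p.2) ∈ M}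
      mul_mem' := fun {c d} hc hd p hp => by simpa [mul_assoc] using hc _ (hd p hp)
      one_mem' := fun p hp => by simpa using hp
      inv_mem' := fun {c} hc => hmem_inv c hc }
  have hHc : IsClosed (H : Set Circle) := by
    have : (H : Set Circle) = ⋂ p ∈ M, {c : Circle | (p.1, c * p.2) ∈ M} := by
      ext c; simp [H]
    rw [this]
    exact isClosed_biInter fun p _ => hMc.preimage (by fun_prop)
  have hH : H ≠ ⊤ := by
    intro htop
    refine hMu (Set.eq_univ_of_forall fun p => ?_)
    obtain ⟨y, hy⟩ := hfst p.1
    have : p.2 * y⁻¹ ∈ H := htop ▸ Subgroup.mem_top _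
    simpa using this _ hy
  obtain ⟨k, hk, hHk⟩ := Circle.exists_pow_eq_one_of_isClosed hHc hH
  have hpow : ∀ x y y', (x, y) ∈ M → (x, y') ∈ M → y' ^ k = y ^ k := by
    intro x y y' h1 h2
    have : y' * y⁻¹ ∈ H := hinter (y' * y⁻¹) x y h1 (by simpa using h2)
    have := hHk _ this
    rwa [mul_pow, inv_pow, mul_inv_eq_one] at this
  -- Each fibre of `M` lies in one coset of `H`, so `s x ^ k` does not depend on the choice of `s`;
  -- compactness of `M` makes it continuous.
  choose s hs using hfst
  have hcont : Continuous fun x => s x ^ k := by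
    rw [continuous_iff_isClosed]
    intro F hF
    have : (fun x => s x ^ k) ⁻¹' F = Prod.fst '' (M ∩ {p | p.2 ^ k ∈ F}) := by
      ext x
      constructor
      · intro hx
        exact ⟨(x, s x), ⟨hs x, hx⟩, rfl⟩
      · rintro ⟨⟨x, y⟩, ⟨h1, h2⟩, rfl⟩
        change s x ^ k ∈ F
        rw [hpow x y (s x) h1 (hs x)]
        exact h2
    rw [this]
    exact ((hMc.inter (hF.preimage (by fun_prop))).isCompact.image continuous_fst).isClosed
  refine ht k (by exact_mod_cast hk) ⟨_, hcont⟩ fun x => ?_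
  have h1 := hMi _ (hs x) 1
  rw [skewProduct_zpow_apply, zpow_one, skewCocycle_one] at h1
  simpa [mul_pow] using hpow _ _ _ h1 (hs (a * x))

end SkewProduct

/-! ### Disintegration of a second invariant measure -/

section NotUniquelyErgodic

theorem Circle.dist_eq_norm_sub (z w : Circle) : dist z w = ‖(z : ℂ) - (w : ℂ)‖ :=
  (show dist z w = dist (z : ℂ) (w : ℂ) from rfl).trans (dist_eq_norm _ _)

theorem Circle.dist_mul_left_eq (c z w : Circle) : dist (c * z) (c * w) = dist z w := by
  rw [Circle.dist_eq_norm_sub, Circle.dist_eq_norm_sub, Circle.coe_mul, Circle.coe_mul, ← mul_sub,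
    norm_mul, Circle.norm_coe, one_mul]

theorem Circle.continuous_coe_complex : Continuous fun z : Circle => (z : ℂ) := by fun_prop

theorem Continuous.circle_coe_zpow {K : Type*} [TopologicalSpace K] {f : K → Circle}
    (hf : Continuous f) (n : ℤ) : Continuous fun x => ((f x ^ n : Circle) : ℂ) :=
  Circle.continuous_coe_complex.comp (hf.zpow n)

variable {a : Circle} {t : C(Circle, Circle)}

theorem map_fst_eq_circleHaar (ha : DenseRange (fun n : ℤ => a ^ n)) {μ : Measure (Circle × Circle)}
    [IsProbabilityMeasure μ] (hμ : MeasurePreserving (skewProduct a t) μ μ) :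
    μ.fst = circleHaar := by
  refine eq_circleHaar_of_measurePreserving ha ⟨by fun_prop, ?_⟩
  rw [Measure.fst, Measure.map_map (by fun_prop) (by fun_prop)]
  have : (fun x => a * x) ∘ Prod.fst = Prod.fst ∘ skewProduct a t := rfl
  rw [this, ← Measure.map_map (by fun_prop) hμ.measurable, hμ.map_eq]

theorem integrable_mul_zpow {K : Type*} [MeasurableSpace K] {μ : Measure K} [IsFiniteMeasure μ]
    {u : K → ℂ} {v : K → Circle} (hu : Measurable u) (hv : Measurable v) {C : ℝ}
    (hC : ∀ x, ‖u x‖ ≤ C) : Integrable (fun x => u x * (v x : ℂ)) μ :=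
  Integrable.of_bound (hu.mul (Circle.continuous_coe_complex.measurable.comp hv)).aestronglyMeasurable C
    (ae_of_all _ fun x => by
      rw [norm_mul, Circle.norm_coe, mul_one]
      exact hC x)

/-- An invariant measure other than Haar measure yields a bounded measurable solution, not almost
everywhere zero, of the cohomological equation for some power of the cocycle. -/
theorem exists_measurable_eigenfunction (ha : DenseRange (fun n : ℤ => a ^ n))
    {μ : Measure (Circle × Circle)} [IsProbabilityMeasure μ]
    (hμ : MeasurePreserving (skewProduct a t) μ μ) (hne : μ ≠ circleHaar.prod circleHaar) :
    ∃ (k : ℤ) (φ : Circle → ℂ), k ≠ 0 ∧ Measurable φ ∧ (∀ x, ‖φ x‖ ≤ 1) ∧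
      (∀ n : ℤ, ∀ᵐ x ∂circleHaar, φ (a ^ n * x) = (skewCocycle a t n x ^ k : Circle) * φ x) ∧
      ¬ ∀ᵐ x ∂circleHaar, φ x = 0 := by
  have hfst := map_fst_eq_circleHaar ha hμ
  -- `φ k x` is a Fourier coefficient of the fibre measure of `μ` over `x`.
  let φ : ℤ → Circle → ℂ := fun k x => ∫ y, ((y ^ k : Circle) : ℂ) ∂(μ.condKernel x)
  have hφm : ∀ k, Measurable (φ k) := fun k => by
    have : StronglyMeasurable (Function.uncurry fun (_ : Circle) (y : Circle) =>
      ((y ^ k : Circle) : ℂ)) := (continuous_snd.circle_coe_zpow k).stronglyMeasurable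
    exact (this.integral_kernel_prod_right (κ := μ.condKernel)).measurable
  have hφb : ∀ k x, ‖φ k x‖ ≤ 1 := fun k x => by
    refine (norm_integral_le_of_norm_le_const (C := 1) (ae_of_all _ fun y => ?_)).trans ?_
    · rw [Circle.norm_coe]
    · simp
  have hint : ∀ (k : ℤ) (u : Circle → ℂ), Measurable u → (∀ x, ‖u x‖ ≤ 1) →
      ∫ p, u p.1 * ((p.2 ^ k : Circle) : ℂ) ∂μ = ∫ x, u x * φ k x ∂circleHaar := by
    intro k u hu hb
    have h := Measure.integral_condKernel (ρ := μ)
      (f := fun p : Circle × Circle => u p.1 * ((p.2 ^ k : Circle) : ℂ))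
      (integrable_mul_zpow (u := fun p : Circle × Circle => u p.1)
        (v := fun p : Circle × Circle => p.2 ^ k) (by fun_prop)
        (Continuous.measurable (by fun_prop)) (fun p => hb p.1))
    rw [← h, hfst]
    simp only [φ, integral_const_mul]
  have hrel : ∀ k n : ℤ, ∀ᵐ x ∂circleHaar,
      φ k (a ^ n * x) = (skewCocycle a t n x ^ k : Circle) * φ k x := by
    intro k n
    have hτ : Measurable fun x => ((skewCocycle a t n x ^ k : Circle) : ℂ) := by
      exact ((continuous_skewCocycle n).circle_coe_zpow k).measurable
    have hφn : Measurable fun x => φ k (a ^ n * x) := (hφm k).comp (by fun_prop)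
    refine Integrable.ae_eq_of_forall_setIntegral_eq _ _
      (Integrable.of_bound hφn.aestronglyMeasurable 1 (ae_of_all _ fun x => hφb _ _))
      (Integrable.of_bound (hτ.mul (hφm k)).aestronglyMeasurable 1 (ae_of_all _ fun x => ?_)) ?_
    · rw [norm_mul, Circle.norm_coe, one_mul]
      exact hφb k x
    intro A hA _
    let u : Circle → ℂ := A.indicator 1
    have hu : Measurable u := measurable_one.indicator hA
    have hub : ∀ x, ‖u x‖ ≤ 1 := fun x => by
      by_cases h : x ∈ A <;> simp [u, h]
    have h1 : ∫ x in A, φ k (a ^ n * x) ∂circleHaar = ∫ x, u x * φ k (a ^ n * x) ∂circleHaar := by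
      rw [← integral_indicator hA]
      congr 1; ext x
      by_cases h : x ∈ A <;> simp [u, h]
    have h2 : ∫ x in A, ((skewCocycle a t n x ^ k : Circle) : ℂ) * φ k x ∂circleHaar =
        ∫ x, (u x * ((skewCocycle a t n x ^ k : Circle) : ℂ)) * φ k x ∂circleHaar := by
      rw [← integral_indicator hA]
      congr 1; ext x
      by_cases h : x ∈ A <;> simp [u, h]
    have hu' : Measurable fun x => u ((a ^ n)⁻¹ * x) := hu.comp (by fun_prop)
    have h3 : ∫ x, u x * φ k (a ^ n * x) ∂circleHaar =
        ∫ x, u ((a ^ n)⁻¹ * x) * φ k x ∂circleHaar := by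
      rw [← integral_mul_left_eq_self (fun x => u ((a ^ n)⁻¹ * x) * φ k x) (a ^ n)]
      simp
    have h4 : ∫ p, u ((a ^ n)⁻¹ * p.1) * ((p.2 ^ k : Circle) : ℂ) ∂μ =
        ∫ p, (u p.1 * ((skewCocycle a t n p.1 ^ k : Circle) : ℂ)) *
          ((p.2 ^ k : Circle) : ℂ) ∂μ := by
      rw [← (hμ.homeomorph_zpow n).integral_comp (skewProduct a t ^ n).measurableEmbedding]
      congr 1; ext p
      simp [skewProduct_zpow_apply, mul_zpow, mul_assoc]
    rw [h1, h2, h3, ← hint k _ hu' (fun x => hub _), h4]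
    refine hint k (fun x => u x * ((skewCocycle a t n x ^ k : Circle) : ℂ)) (hu.mul hτ) fun x => ?_
    rw [norm_mul, Circle.norm_coe, mul_one]
    exact hub x
  -- If every `φ k` with `k ≠ 0` vanished almost everywhere, `μ` would have the Fourier coefficients
  -- of the product Haar measure.
  by_contra hcon
  push Not at hcon
  have hzero : ∀ k : ℤ, k ≠ 0 → ∀ᵐ x ∂circleHaar, φ k x = 0 := fun k hk =>
    hcon k (φ k) hk (hφm k) (hφb k) (hrel k)
  refine hne (Measure.ext_of_integral_zpow_mul_zpow fun i j => ?_)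
  by_cases hj : j = 0
  · subst hj
    have h1 : ∫ p, ((p.1 ^ i * p.2 ^ (0 : ℤ) : Circle) : ℂ) ∂μ =
        ∫ x, ((x ^ i : Circle) : ℂ) ∂μ.fst := by
      rw [Measure.fst, integral_map measurable_fst.aemeasurable
        (f := fun x : Circle => ((x ^ i : Circle) : ℂ))
        (continuous_id.circle_coe_zpow i).aestronglyMeasurable]
      simp
    have h2 : ∫ p, ((p.1 ^ i * p.2 ^ (0 : ℤ) : Circle) : ℂ) ∂(circleHaar.prod circleHaar) =
        ∫ x, ((x ^ i : Circle) : ℂ) ∂(circleHaar.prod circleHaar).fst := by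
      rw [Measure.fst, integral_map measurable_fst.aemeasurable
        (f := fun x : Circle => ((x ^ i : Circle) : ℂ))
        (continuous_id.circle_coe_zpow i).aestronglyMeasurable]
      simp
    rw [h1, h2, hfst, Measure.fst_prod]
  · have h1 : ∫ p, ((p.1 ^ i * p.2 ^ j : Circle) : ℂ) ∂μ = 0 := by
      simp only [Circle.coe_mul]
      rw [hint j (fun x => ((x ^ i : Circle) : ℂ)) (continuous_id.circle_coe_zpow i).measurable
        (fun x => (Circle.norm_coe _).le)]
      refine integral_eq_zero_of_ae ?_
      filter_upwards [hzero j hj] with x hx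
      simp [hx]
    rw [h1]
    simp only [Circle.coe_mul]
    rw [integral_prod_mul (fun x : Circle => ((x ^ i : Circle) : ℂ))
      (fun x : Circle => ((x ^ j : Circle) : ℂ)),
      integral_zpow_eq_zero (measurePreserving_mul_left _ a)
        (Circle.zpow_ne_one_of_denseRange ha hj), mul_zero]

end NotUniquelyErgodic

/-! ### Equicontinuous factors -/

section Equicontinuous

variable {a : Circle} {t : C(Circle, Circle)}

/-- If a minimal skew product has an equicontinuous factor that does not factor through the first
projection, then some power of its cocycle is equicontinuous. -/
theorem exists_equicontinuous_skewCocycle_pow (hT : IsMinimalSystem (skewProduct a t))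
    {Z : Type*} [UniformSpace Z] [T2Space Z] {R : Z ≃ₜ Z} {ψ : Circle × Circle → Z}
    (hψ : IsFactorMap (skewProduct a t) R ψ) (hR : IsEquicontinuousSystem R) {x₀ y₀ y₁ : Circle}
    (hne : ψ (x₀, y₀) ≠ ψ (x₀, y₁)) :
    ∃ k : ℕ, k ≠ 0 ∧ Equicontinuous fun (n : ℤ) (x : Circle) => skewCocycle a t n x ^ k := by
  have hψc := hψ.continuous
  have hequiv := Homeomorph.semiconj_zpow hψ.equivariant
  let H : Subgroup Circle :=
    { carrier := {c | ∀ p : Circle × Circle, ψ (p.1, c * p.2) = ψ p}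
      mul_mem' := fun {c d} hc hd p => by
        have := hc (p.1, d * p.2)
        rw [hd] at this
        simpa only [mul_assoc] using this
      one_mem' := fun p => by simp
      inv_mem' := fun {c} hc p => by simpa using (hc (p.1, c⁻¹ * p.2)).symm }
  have hHc : IsClosed (H : Set Circle) := by
    have : (H : Set Circle) = ⋂ p : Circle × Circle, {c : Circle | ψ (p.1, c * p.2) = ψ p} := by
      ext c; simp [H]
    rw [this]
    exact isClosed_iInter fun p => isClosed_eq (by fun_prop) continuous_const
  have hH : H ≠ ⊤ := by
    intro htop
    have : y₁ * y₀⁻¹ ∈ H := htop ▸ Subgroup.mem_top _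
    exact hne (by simpa using (this (x₀, y₀)).symm)
  have hmem : ∀ c x y, ψ (x, c * y) = ψ (x, y) → c ∈ H := by
    intro c x y h
    have := hT.eq_univ (s := {p : Circle × Circle | ψ (p.1, c * p.2) = ψ p})
      (isClosed_eq (by fun_prop) hψc) (fun p hp n => by
        have h1 := hequiv n (p.1, c * p.2)
        rw [hp, ← hequiv] at h1
        simp only [skewProduct_zpow_apply] at h1 ⊢
        simpa only [Set.mem_ofPred_eq, mul_left_comm] using h1) ⟨(x, y), h⟩
    exact fun p => this.ge (Set.mem_univ p)
  obtain ⟨k, hk, hHk⟩ := Circle.exists_pow_eq_one_of_isClosed hHc hH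
  refine ⟨k, hk, fun x => ?_⟩
  refine Metric.equicontinuousAt_iff_right.2 ?_
  by_contra hcon
  push Not at hcon
  obtain ⟨ε, hε, hfreq⟩ := hcon
  obtain ⟨xs, hxs, hbad⟩ := exists_seq_forall_of_frequently hfreq
  choose ns hns using hbad
  -- Failure of equicontinuity at `x` gives pairs of iterates whose limits `p`, `q` lie in one
  -- fibre. Equicontinuity of `R` forces `ψ p = ψ q`, hence equal `k`-th powers of the second
  -- coordinates, against the gap `ε`.
  let P : ℕ → (Circle × Circle) × (Circle × Circle) := fun i =>
    ((skewProduct a t ^ ns i) (x, 1), (skewProduct a t ^ ns i) (xs i, 1))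
  obtain ⟨⟨p, q⟩, θ, hθ, hlim⟩ := CompactSpace.tendsto_subseq P
  have hp : Tendsto (fun i => (P (θ i)).1) atTop (𝓝 p) := (continuous_fst.tendsto _).comp hlim
  have hq : Tendsto (fun i => (P (θ i)).2) atTop (𝓝 q) := (continuous_snd.tendsto _).comp hlim
  have hxθ : Tendsto (fun i => xs (θ i)) atTop (𝓝 x) := hxs.comp hθ.tendsto_atTop
  have hfst : q.1 = p.1 := by
    have h1 : Tendsto (fun i => (P (θ i)).2.1 * x) atTop (𝓝 (q.1 * x)) :=
      (((continuous_fst.tendsto _).comp hq)).mul_const x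
    have h2 : Tendsto (fun i => (P (θ i)).1.1 * xs (θ i)) atTop (𝓝 (p.1 * x)) :=
      (((continuous_fst.tendsto _).comp hp)).mul hxθ
    have h3 : (fun i => (P (θ i)).2.1 * x) = fun i => (P (θ i)).1.1 * xs (θ i) := by
      funext i
      simp only [P, skewProduct_zpow_apply]
      rw [mul_right_comm]
    rw [h3] at h1
    exact mul_right_cancel (tendsto_nhds_unique h1 h2)
  have hψeq : ψ q = ψ p := by
    have h1 : Tendsto (fun i => ψ (P (θ i)).1) atTop (𝓝 (ψ p)) := (hψc.tendsto _).comp hp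
    have h2 : Tendsto (fun i => ψ (P (θ i)).2) atTop (𝓝 (ψ q)) := (hψc.tendsto _).comp hq
    refine tendsto_nhds_unique h2 (h1.congr_uniformity ?_)
    intro V hV
    have h3 := hR (ψ (x, 1)) V hV
    have h4 : Tendsto (fun i => ψ (xs (θ i), 1)) atTop (𝓝 (ψ (x, 1))) :=
      ((by fun_prop : Continuous fun z : Circle => ψ (z, 1)).tendsto x).comp hxθ
    rw [mem_map]
    filter_upwards [h4.eventually h3] with i hi
    have := hi ⟨fun z => (R ^ ns (θ i)) z, subset_closure ⟨ns (θ i), rfl⟩⟩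
    simp only [← hequiv] at this
    exact this
  have hpow : q.2 ^ k = p.2 ^ k := by
    have : q.2 * p.2⁻¹ ∈ H := hmem _ p.1 p.2 (by
      rw [inv_mul_cancel_right, ← hfst, Prod.mk.eta, hψeq, hfst])
    have := hHk _ this
    rwa [mul_pow, inv_pow, mul_inv_eq_one] at this
  have hd : Tendsto (fun i => dist ((P (θ i)).1.2 ^ k) ((P (θ i)).2.2 ^ k)) atTop
      (𝓝 (dist (p.2 ^ k) (q.2 ^ k))) :=
    ((((continuous_snd.tendsto _).comp hp)).pow k).dist
      ((((continuous_snd.tendsto _).comp hq)).pow k)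
  have hle := ge_of_tendsto' hd fun i => hns (θ i)
  rw [hpow, dist_self] at hle
  exact absurd hε (not_lt.2 hle)

/-- Equicontinuity of a power of the cocycle is incompatible with minimality when a power of the
cocycle is a measurable coboundary. -/
theorem not_equicontinuous_skewCocycle_pow (ha : DenseRange (fun n : ℤ => a ^ n))
    (hT : IsMinimalSystem (skewProduct a t)) {k : ℤ} (hk : k ≠ 0) {φ : Circle → ℂ}
    (hφm : Measurable φ) (hφb : ∀ x, ‖φ x‖ ≤ 1)
    (hφ : ∀ n : ℤ, ∀ᵐ x ∂circleHaar, φ (a ^ n * x) = (skewCocycle a t n x ^ k : Circle) * φ x)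
    (hφ0 : ¬ ∀ᵐ x ∂circleHaar, φ x = 0) {l : ℕ} (hl : l ≠ 0) :
    ¬ Equicontinuous fun (n : ℤ) (x : Circle) => skewCocycle a t n x ^ l := by
  intro heq
  obtain ⟨ζ, hζ⟩ := Circle.exists_zpow_eq (-1) (mul_ne_zero (Int.natCast_ne_zero.2 hl) hk)
  obtain ⟨p, hp, hlim⟩ := mem_closure_iff_seq_limit.1 (hT (1, 1) (1, ζ))
  choose n hn using hp
  have hpn : p = fun i => (a ^ n i, skewCocycle a t (n i) 1) := by
    funext i
    rw [← hn i]
    simp only [skewProduct_zpow_apply, mul_one]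
  rw [hpn] at hlim
  have hlim1 : Tendsto (fun i => a ^ n i) atTop (𝓝 1) := (continuous_fst.tendsto _).comp hlim
  have hlim2 : Tendsto (fun i => skewCocycle a t (n i) 1) atTop (𝓝 ζ) :=
    (continuous_snd.tendsto _).comp hlim
  -- Expanding the cocycle of `n i + m` in both orders compares its values at `a ^ m` and at `1`;
  -- the discrepancy tends to 1 because `a ^ n i` does.
  have horbit : ∀ m : ℤ, Tendsto (fun i => skewCocycle a t (n i) (a ^ m)) atTop (𝓝 ζ) := by
    intro m
    have hc : ∀ i, skewCocycle a t (n i) (a ^ m) = skewCocycle a t m (a ^ n i) *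
        skewCocycle a t (n i) 1 * (skewCocycle a t m 1)⁻¹ := by
      intro i
      have h1 := skewCocycle_add (a := a) (t := t) (n i) m 1
      rw [add_comm, skewCocycle_add, mul_one, mul_one] at h1
      rw [h1, mul_inv_cancel_right]
    simp only [hc]
    have h1 : Tendsto (fun i => skewCocycle a t m (a ^ n i)) atTop (𝓝 (skewCocycle a t m 1)) :=
      ((continuous_skewCocycle m).tendsto 1).comp hlim1
    simpa using (h1.mul hlim2).mul_const (skewCocycle a t m 1)⁻¹
  have hall : ∀ x, Tendsto (fun i => skewCocycle a t (n i) x ^ l) atTop (𝓝 (ζ ^ l)) := by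
    intro x
    exact ha.induction_on (p := fun x => Tendsto (fun i => skewCocycle a t (n i) x ^ l) atTop
      (𝓝 (ζ ^ l))) x
      ((heq.comp n).isClosed_setOfPred_tendsto continuous_const) fun m => (horbit m).pow l
  have hall' : ∀ x, Tendsto (fun i => ((skewCocycle a t (n i) x ^ (l * k) : Circle) : ℂ)) atTop
      (𝓝 (-1)) := by
    intro x
    have h1 := (hall x).zpow k
    simp only [← zpow_natCast, ← zpow_mul] at h1
    rw [hζ] at h1
    have h2 := (Circle.continuous_coe_complex.tendsto _).comp h1
    rwa [Circle.coe_neg, Circle.coe_one] at h2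
  -- One family of integrals has limit `-c` by dominated convergence and limit `c` by translation
  -- invariance of Haar measure.
  have hfourier : ∀ j : ℤ, ∫ x, φ x ^ l * ((x ^ j : Circle) : ℂ) ∂circleHaar = 0 := by
    intro j
    set c := ∫ x, φ x ^ l * ((x ^ j : Circle) : ℂ) ∂circleHaar with hc
    have h1 : ∀ m : ℤ, ∫ x, ((skewCocycle a t m x ^ (l * k) : Circle) : ℂ) *
        (φ x ^ l * ((x ^ j : Circle) : ℂ)) ∂circleHaar = ((((a ^ m) ^ j)⁻¹ : Circle) : ℂ) * c := by
      intro m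
      have h2 := integral_mul_left_eq_self (μ := circleHaar)
        (fun x => φ x ^ l * ((x ^ j : Circle) : ℂ)) (a ^ m)
      rw [hc, ← h2, ← integral_const_mul]
      refine integral_congr_ae ?_
      filter_upwards [hφ m] with x hx
      rw [hx, mul_pow, mul_comm (l : ℤ) k, zpow_mul, zpow_natCast, mul_zpow]
      have h5 : ((((a ^ m) ^ j)⁻¹ : Circle) : ℂ) * (((a ^ m) ^ j : Circle) : ℂ) = 1 := by
        rw [← Circle.coe_mul, inv_mul_cancel, Circle.coe_one]
      rw [Circle.coe_mul, Circle.coe_pow]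
      linear_combination (-((skewCocycle a t m x ^ k : Circle) : ℂ) ^ l * φ x ^ l *
        ((x ^ j : Circle) : ℂ)) * h5
    have hmeas : ∀ m : ℤ, AEStronglyMeasurable (fun x =>
        ((skewCocycle a t m x ^ (l * k) : Circle) : ℂ) * (φ x ^ l * ((x ^ j : Circle) : ℂ)))
        circleHaar := by
      intro m
      exact (((continuous_skewCocycle m).circle_coe_zpow _).measurable.mul
        ((hφm.pow_const l).mul
          (continuous_id.circle_coe_zpow j).measurable)).aestronglyMeasurable
    have h3 : Tendsto (fun i => ∫ x, ((skewCocycle a t (n i) x ^ (l * k) : Circle) : ℂ) *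
        (φ x ^ l * ((x ^ j : Circle) : ℂ)) ∂circleHaar) atTop
        (𝓝 (∫ x, (-1) * (φ x ^ l * ((x ^ j : Circle) : ℂ)) ∂circleHaar)) := by
      refine tendsto_integral_of_dominated_convergence (fun _ => 1) (fun i => hmeas (n i))
        (integrable_const _) (fun i => ae_of_all _ fun x => ?_)
        (ae_of_all _ fun x => (hall' x).mul_const _)
      rw [norm_mul, norm_mul, Circle.norm_coe, Circle.norm_coe, one_mul, mul_one, norm_pow]
      exact pow_le_one₀ (norm_nonneg _) (hφb x)
    simp only [h1] at h3
    rw [integral_const_mul, ← hc] at h3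
    have h4 : Tendsto (fun i => ((((a ^ n i) ^ j)⁻¹ : Circle) : ℂ) * c) atTop (𝓝 (1 * c)) := by
      have h5 : Tendsto (fun i => ((a ^ n i) ^ j)⁻¹) atTop (𝓝 1) := by
        simpa using (hlim1.zpow j).inv
      have h6 := (Circle.continuous_coe_complex.tendsto _).comp h5
      rw [Circle.coe_one] at h6
      exact h6.mul_const c
    have h6 := tendsto_nhds_unique h3 h4
    have h7 : (2 : ℂ) * c = 0 := by linear_combination -h6
    simpa using h7
  refine hφ0 ?_
  have := ae_eq_zero_of_integral_mul_zpow_eq_zero (hφm.pow_const l) (C := 1)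
    (fun x => by simpa using pow_le_one₀ (norm_nonneg _) (hφb x)) hfourier
  filter_upwards [this] with x hx
  exact pow_eq_zero_iff hl |>.1 hx

theorem isEquicontinuousSystem_circleRotation (a : Circle) :
    IsEquicontinuousSystem (circleRotation a) := by
  refine Set.Equicontinuous.closure ?_
  intro x
  refine Metric.equicontinuousAt_iff_right.2 ?_
  intro ε hε
  filter_upwards [Metric.ball_mem_nhds x hε] with y hy
  rintro ⟨_, n, rfl⟩
  simp only [circleRotation_zpow_apply]
  rw [Metric.mem_ball, dist_comm] at hy
  convert hy using 1
  exact Circle.dist_mul_left_eq _ _ _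

theorem isMaximalEquicontinuousFactor_skewProduct (ha : DenseRange (fun n : ℤ => a ^ n))
    (hT : IsMinimalSystem (skewProduct a t)) (hE : ¬ IsUniquelyErgodic (skewProduct a t)) :
    IsMaximalEquicontinuousFactor.{0, 0, w} (skewProduct a t) (circleRotation a) Prod.fst where
  isFactorMap := ⟨continuous_fst, Prod.fst_surjective, fun _ => rfl⟩
  equicontinuous := isEquicontinuousSystem_circleRotation a
  maximal := by
    intro Z _ _ _ R ψ hψ hR
    have hfst : ∀ x y, ψ (x, 1) = ψ (x, y) := by
      by_contra hcon
      push Not at hcon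
      obtain ⟨x, y, hxy⟩ := hcon
      obtain ⟨l, hl, heq⟩ := exists_equicontinuous_skewCocycle_pow hT hψ hR hxy
      -- Product Haar measure is always invariant, so failure of `∃!` can only mean a second
      -- invariant measure.
      have hμ : ∃ μ ∈ invariantMeasures (skewProduct a t), μ ≠ circleHaar.prod circleHaar := by
        by_contra hcon
        push Not at hcon
        exact hE ⟨circleHaar.prod circleHaar,
          ⟨inferInstance, inferInstance, measurePreserving_skewProduct_prod a t⟩, hcon⟩
      obtain ⟨μ, ⟨_, _, hμT⟩, hμ⟩ := hμ
      obtain ⟨k, φ, hk, hφm, hφb, hφ, hφ0⟩ := exists_measurable_eigenfunction ha hμT hμ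
      exact not_equicontinuous_skewCocycle_pow ha hT hk hφm hφb hφ hφ0 hl heq
    have hψc := hψ.continuous
    refine ⟨fun x => ψ (x, 1), ⟨by fun_prop, fun z => ?_, fun x => ?_⟩, fun p => hfst p.1 p.2⟩
    · obtain ⟨p, rfl⟩ := hψ.surjective z
      exact ⟨p.1, hfst p.1 p.2⟩
    · rw [← hψ.equivariant]
      exact hfst _ _

end Equicontinuous

/-! ### Almost invariant spikes -/

section Spikes

variable {a : Circle}

theorem Circle.dist_pow_one_le (z : Circle) (n : ℕ) : dist (z ^ n) 1 ≤ n * dist z 1 := by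
  induction n with
  | zero => simp
  | succ n ih =>
    have h1 : dist (z ^ (n + 1)) (z ^ n) = dist z 1 := by
      rw [pow_succ]
      simpa using Circle.dist_mul_left_eq (z ^ n) z 1
    have h2 := dist_triangle (z ^ (n + 1)) (z ^ n) 1
    push_cast
    linarith

theorem Circle.dist_neg_one_one : dist (-1 : Circle) 1 = 2 := by
  rw [Circle.dist_eq_norm_sub]
  norm_num

/-- Large powers of suitable points near `1` are equal to `-1`. -/
theorem Circle.eventually_exists_pow_eq_neg_one {ε : ℝ} (hε : 0 < ε) :
    ∀ᶠ n : ℕ in atTop, ∃ w : Circle, dist w 1 < ε ∧ w ^ n = -1 := by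
  have h1 : Tendsto (fun n : ℕ => Circle.exp (Real.pi / n)) atTop (𝓝 1) := by
    have h2 : Tendsto (fun n : ℕ => Real.pi / n) atTop (𝓝 0) :=
      tendsto_const_div_atTop_nhds_zero_nat Real.pi
    have := (Circle.exp.continuous.tendsto 0).comp h2
    rwa [Circle.exp_zero] at this
  filter_upwards [h1.eventually (Metric.ball_mem_nhds 1 hε), eventually_ne_atTop 0] with n hn hn0
  refine ⟨_, hn, ?_⟩
  rw [← Circle.exp_nsmul, nsmul_eq_mul, mul_div_cancel₀ _ (Nat.cast_ne_zero.2 hn0)]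
  ext
  simp

/-- For `n` large some `w` near 1 has `w ^ n = -1`, and a power `a ^ N` close to `w` inherits the
gap. Thus a spike in `x ^ n` hardly changes under `a`, yet drops to 0 at `a ^ N`. -/
theorem exists_pow_near_one_of_denseRange (ha : DenseRange (fun n : ℤ => a ^ n)) {δ : ℝ}
    (hδ : 0 < δ) : ∃ n N : ℕ, n ≠ 0 ∧ dist (a ^ n) 1 < δ ∧ dist (a ^ N) 1 < δ ∧
      1 ≤ dist (a ^ (N * n)) 1 := by
  have ha' : DenseRange (fun n : ℕ => a ^ n) := denseRange_zpow_iff_pow.1 ha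
  obtain ⟨M, hM⟩ := eventually_atTop.1 (Circle.eventually_exists_pow_eq_neg_one hδ)
  have hM1 : (0 : ℝ) < (M + 1 : ℕ) := by positivity
  -- The tolerance `δ / (M + 1)` allows passing to the exponent `n₀ * (M + 1)`, which is at least
  -- `M`, while staying within `δ` of 1.
  obtain ⟨n₀, hn₀, hn₀'⟩ : ∃ n₀ : ℕ, n₀ ≠ 0 ∧ dist (a ^ n₀) 1 < δ / (M + 1 : ℕ) := by
    obtain ⟨m, hm⟩ :=
      (Circle.eventually_exists_pow_eq_neg_one (div_pos hδ hM1)).exists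
    obtain ⟨w, hw, hwm⟩ := hm
    have hw1 : w ≠ 1 := by
      rintro rfl
      rw [one_pow] at hwm
      exact Circle.neg_one_ne_one hwm.symm
    obtain ⟨n₀, h1, h2⟩ := ha'.exists_mem_open
      ((Metric.isOpen_ball (x := (1 : Circle)) (ε := δ / (M + 1 : ℕ))).inter
        (isOpen_compl_singleton (x := (1 : Circle)))) ⟨w, hw, hw1⟩
    refine ⟨n₀, ?_, h1⟩
    rintro rfl
    exact h2 (pow_zero a)
  have hle : M ≤ n₀ * (M + 1) := by nlinarith [Nat.pos_of_ne_zero hn₀]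
  obtain ⟨w, hw, hwn⟩ := hM _ hle
  have hopen : IsOpen {z : Circle | dist z 1 < δ ∧ 1 < dist (z ^ (n₀ * (M + 1))) 1} :=
    IsOpen.and (isOpen_lt (by fun_prop) continuous_const)
      (isOpen_lt continuous_const (by fun_prop))
  obtain ⟨N, hN1, hN2⟩ := ha'.exists_mem_open hopen
    ⟨w, hw, by rw [hwn, Circle.dist_neg_one_one]; norm_num⟩
  refine ⟨n₀ * (M + 1), N, mul_ne_zero hn₀ (Nat.succ_ne_zero M), ?_, hN1, ?_⟩
  · rw [pow_mul]
    refine (Circle.dist_pow_one_le _ _).trans_lt ?_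
    rwa [lt_div_iff₀' hM1] at hn₀'
  · rw [pow_mul]
    exact hN2.le

/-- A tent function on the circle with peak at `1` and slope `C`. -/
noncomputable def circleTent (C : ℝ) (z : Circle) : ℝ := max 0 (1 - C * dist z 1)

theorem continuous_circleTent (C : ℝ) : Continuous (circleTent C) := by
  unfold circleTent; fun_prop

theorem circleTent_nonneg (C : ℝ) (z : Circle) : 0 ≤ circleTent C z := le_max_left _ _

theorem circleTent_one (C : ℝ) : circleTent C 1 = 1 := by simp [circleTent]

theorem circleTent_eq_zero {C : ℝ} (hC : 1 ≤ C) {z : Circle} (hz : 1 ≤ dist z 1) :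
    circleTent C z = 0 := max_eq_left (by nlinarith)

theorem abs_circleTent_sub_le {C : ℝ} (hC : 0 ≤ C) (z w : Circle) :
    |circleTent C z - circleTent C w| ≤ C * dist z w := by
  have h1 := abs_max_sub_max_le_max 0 (1 - C * dist z 1) 0 (1 - C * dist w 1)
  have h2 : |1 - C * dist z 1 - (1 - C * dist w 1)| ≤ C * dist z w := by
    have : 1 - C * dist z 1 - (1 - C * dist w 1) = C * (dist w 1 - dist z 1) := by ring
    rw [this, abs_mul, abs_of_nonneg hC, dist_comm z w]
    exact mul_le_mul_of_nonneg_left (abs_dist_sub_le w z 1) hC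
  refine h1.trans (max_le ?_ h2)
  simpa using mul_nonneg hC dist_nonneg

/-- As the slope grows, tents tend to 0 off the point 1, which is null since it is not isolated;
dominated convergence applies. -/
theorem exists_lintegral_circleTent_le {ε : ENNReal} (hε : ε ≠ 0) :
    ∃ C : ℝ, 1 ≤ C ∧ ∫⁻ x, ENNReal.ofReal (circleTent C x) ∂circleHaar ≤ ε := by
  have hnull : ∀ᵐ x ∂circleHaar, x ≠ (1 : Circle) := by
    have : (𝓝[≠] (1 : Circle)).NeBot := by
      rw [← mem_closure_iff_nhdsWithin_neBot, Metric.mem_closure_iff]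
      intro ε hε
      obtain ⟨n, w, hw, hwn⟩ := (Circle.eventually_exists_pow_eq_neg_one hε).exists
      refine ⟨w, ?_, by rwa [dist_comm]⟩
      rintro rfl
      rw [one_pow] at hwn
      exact Circle.neg_one_ne_one hwn.symm
    exact compl_mem_ae_iff.2 (measure_singleton (1 : Circle))
  have hlim : Tendsto (fun n : ℕ => ∫⁻ x, ENNReal.ofReal (circleTent n x) ∂circleHaar) atTop
      (𝓝 (∫⁻ _, 0 ∂circleHaar)) := by
    refine tendsto_lintegral_of_dominated_convergence (fun _ => 1)
      (fun n => (continuous_circleTent n).measurable.ennreal_ofReal) (fun n => ae_of_all _ fun x => ?_)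
      (by simp) ?_
    · refine ENNReal.ofReal_le_one.2 (max_le zero_le_one ?_)
      have := mul_nonneg (Nat.cast_nonneg (α := ℝ) n) (dist_nonneg (x := x) (y := 1))
      linarith
    · filter_upwards [hnull] with x hx
      have hd : 0 < dist x 1 := dist_pos.2 hx
      obtain ⟨m, hm⟩ := exists_nat_gt (1 / dist x 1)
      refine tendsto_const_nhds.congr' ?_
      filter_upwards [eventually_ge_atTop m] with n hn
      rw [div_lt_iff₀ hd] at hm
      have : (m : ℝ) * dist x 1 ≤ n * dist x 1 := by gcongr
      rw [circleTent, max_eq_left (by linarith), ENNReal.ofReal_zero]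
  rw [lintegral_zero] at hlim
  obtain ⟨n, hn, hn1⟩ := ((hlim.eventually (ge_mem_nhds (pos_iff_ne_zero.2 hε))).and
    (eventually_ge_atTop 1)).exists
  exact ⟨n, by exact_mod_cast hn1, hn⟩

/-- Nonconstant characters stay nonconstant under the `n`-th power map, so the image measure has the
Fourier coefficients of Haar measure. Hence composing a tent with a power keeps its mean. -/
theorem measurePreserving_pow_circleHaar {n : ℕ} (hn : n ≠ 0) :
    MeasurePreserving (fun x : Circle => x ^ n) circleHaar circleHaar := by
  have hm : Measurable fun x : Circle => x ^ n := Continuous.measurable (by fun_prop)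
  have : IsProbabilityMeasure (Measure.map (fun x : Circle => x ^ n) circleHaar) :=
    Measure.isProbabilityMeasure_map hm.aemeasurable
  refine ⟨hm, Measure.ext_of_integral_zpow fun i => ?_⟩
  by_cases hi : i = 0
  · simp [hi]
  · have hd := Circle.denseRange_zpow_of_irrational irrational_sqrt_two
    rw [integral_map hm.aemeasurable (f := fun x : Circle => ((x ^ i : Circle) : ℂ))
      (continuous_id.circle_coe_zpow i).aestronglyMeasurable,
      integral_zpow_eq_zero (measurePreserving_mul_left _ _)
        (Circle.zpow_ne_one_of_denseRange hd hi)]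
    simp only [← zpow_natCast, ← zpow_mul]
    exact integral_zpow_eq_zero (measurePreserving_mul_left _ _)
      (Circle.zpow_ne_one_of_denseRange hd (mul_ne_zero (Int.natCast_ne_zero.2 hn) hi))

/-- A sequence of spikes with small mean, almost invariant under the rotation by `a`, whose total
increment between `1` and suitable points `a ^ N l` near `1` tends to `-1`. -/
theorem exists_almost_invariant_spikes (ha : DenseRange (fun n : ℤ => a ^ n)) :
    ∃ (G : ℕ → C(Circle, ℝ)) (N : ℕ → ℕ), (∀ i x, 0 ≤ G i x) ∧
      (∀ i, ∫⁻ x, ENNReal.ofReal (G i x) ∂circleHaar ≤ (2⁻¹ : ENNReal) ^ i) ∧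
      (∀ i x, |G i (a * x) - G i x| ≤ (1 / 2 : ℝ) ^ i) ∧
      Tendsto (fun l => a ^ N l) atTop (𝓝 1) ∧
      Tendsto (fun l => ∑' i, (G i (a ^ N l) - G i 1)) atTop (𝓝 (-1)) := by
  choose C hC1 hC using fun l : ℕ =>
    exists_lintegral_circleTent_le (ε := (2⁻¹ : ENNReal) ^ l) (by simp)
  have hC0 : ∀ l, 0 ≤ C l := fun l => zero_le_one.trans (hC1 l)
  -- Triples are (level, `n`, `N`): the level fixes slope and error, the spike is a tent in `x ^ n`,
  -- and `N` is its test time. The relation says that a later spike barely moves at earlier test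
  -- times, and an earlier spike barely moves at later ones.
  obtain ⟨f, hP, hr⟩ := exists_seq_of_forall_finset_exists
    (fun y : ℕ × ℕ × ℕ => y.2.1 ≠ 0 ∧ C y.1 * dist (a ^ y.2.1) 1 ≤ (1 / 2 : ℝ) ^ y.1 ∧
      dist (a ^ y.2.2) 1 ≤ (1 / 2 : ℝ) ^ y.1 ∧ 1 ≤ dist (a ^ (y.2.2 * y.2.1)) 1)
    (fun x y : ℕ × ℕ × ℕ => x.1 < y.1 ∧
      C y.1 * (x.2.2 * dist (a ^ y.2.1) 1) ≤ (1 / 2 : ℝ) ^ y.1 ∧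
      C x.1 * (x.2.1 * dist (a ^ y.2.2) 1) ≤ (1 / 2 : ℝ) ^ y.1) (by
    intro s _
    let l := s.sup Prod.fst + 1
    -- `B` dominates the coefficients of all interactions with earlier triples; adding `C l ≥ 1`
    -- covers the conditions on the new triple alone.
    let B := ∑ x ∈ s, (C l * x.2.2 + C x.1 * x.2.1)
    have hterm : ∀ x : ℕ × ℕ × ℕ, 0 ≤ C l * x.2.2 ∧ 0 ≤ C x.1 * x.2.1 := fun x =>
      ⟨mul_nonneg (hC0 _) (Nat.cast_nonneg _), mul_nonneg (hC0 _) (Nat.cast_nonneg _)⟩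
    have hB : 0 ≤ B := Finset.sum_nonneg fun x _ => add_nonneg (hterm x).1 (hterm x).2
    have hBl : 0 < B + C l := add_pos_of_nonneg_of_pos hB (zero_lt_one.trans_le (hC1 l))
    obtain ⟨n, N, hn, h1, h2, h3⟩ := exists_pow_near_one_of_denseRange ha
      (div_pos (pow_pos (by norm_num : (0 : ℝ) < 1 / 2) l) hBl)
    have hkey : ∀ c d : ℝ, c ≤ B + C l → 0 ≤ d → d < (1 / 2) ^ l / (B + C l) →
        c * d ≤ (1 / 2) ^ l := by
      intro c d hc hd hlt
      rw [lt_div_iff₀' hBl] at hlt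
      exact (mul_le_mul_of_nonneg_right hc hd).trans hlt.le
    have hle : ∀ x ∈ s, C l * x.2.2 + C x.1 * x.2.1 ≤ B := fun x hx =>
      Finset.single_le_sum (f := fun x : ℕ × ℕ × ℕ => C l * x.2.2 + C x.1 * x.2.1)
        (fun x _ => add_nonneg (hterm x).1 (hterm x).2) hx
    refine ⟨(l, n, N), ⟨hn, hkey _ _ (by linarith) dist_nonneg h1, ?_, h3⟩, fun x hx => ⟨?_, ?_, ?_⟩⟩
    · simpa using hkey 1 _ (by linarith [hC1 l]) dist_nonneg h2
    · exact Nat.lt_succ_of_le (Finset.le_sup (f := Prod.fst) hx)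
    · rw [← mul_assoc]
      exact hkey _ _ (by linarith [hle x hx, hterm x, hC0 l]) dist_nonneg h1
    · rw [← mul_assoc]
      exact hkey _ _ (by linarith [hle x hx, hterm x, hC0 l]) dist_nonneg h2)
  have hid : ∀ i, i ≤ (f i).1 := fun _ =>
    StrictMono.le_apply (f := fun i => (f i).1) fun i j hij => (hr i j hij).1
  have hpow : ∀ i, (1 / 2 : ℝ) ^ (f i).1 ≤ (1 / 2) ^ i := fun i =>
    pow_le_pow_of_le_one (by norm_num) (by norm_num) (hid i)
  have hhalf : Tendsto (fun l : ℕ => (1 / 2 : ℝ) ^ l) atTop (𝓝 0) :=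
    tendsto_pow_atTop_nhds_zero_of_lt_one (by norm_num) (by norm_num)
  refine ⟨fun i => ⟨fun x => circleTent (C (f i).1) (x ^ (f i).2.1),
    (continuous_circleTent _).comp (continuous_pow _)⟩, fun i => (f i).2.2,
    fun i x => circleTent_nonneg _ _, fun i => ?_, fun i x => ?_, ?_, ?_⟩
  · have hmp := measurePreserving_pow_circleHaar (hP i).1
    have := hmp.lintegral_comp (f := fun x => ENNReal.ofReal (circleTent (C (f i).1) x))
      (continuous_circleTent _).measurable.ennreal_ofReal
    change ∫⁻ x, ENNReal.ofReal (circleTent (C (f i).1) (x ^ (f i).2.1)) ∂circleHaar ≤ _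
    rw [this]
    exact (hC _).trans (pow_le_pow_right_of_le_one' (by simp) (hid i))
  · refine ((abs_circleTent_sub_le (hC0 _) _ _).trans ?_).trans ((hP i).2.1.trans (hpow i))
    rw [mul_pow, mul_comm]
    nth_rewrite 2 [← mul_one (x ^ (f i).2.1)]
    rw [mul_comm (a ^ (f i).2.1), Circle.dist_mul_left_eq, mul_comm]
  · rw [tendsto_iff_dist_tendsto_zero]
    exact squeeze_zero (fun _ => dist_nonneg) (fun l => (hP l).2.2.1.trans (hpow l)) hhalf
  · let d : ℕ → ℕ → ℝ := fun l i =>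
      circleTent (C (f i).1) ((a ^ (f l).2.2) ^ (f i).2.1) - circleTent (C (f i).1) (1 ^ (f i).2.1)
    have hd : ∀ l i, |d l i| ≤ C (f i).1 * dist (a ^ ((f l).2.2 * (f i).2.1)) 1 := fun l i => by
      simpa [d, pow_mul] using abs_circleTent_sub_le (hC0 (f i).1)
        ((a ^ (f l).2.2) ^ (f i).2.1) (1 ^ (f i).2.1)
    have hlt : ∀ l i, i < l → |d l i| ≤ (1 / 2) ^ l := fun l i hil => by
      refine ((hd l i).trans ?_).trans ((hr i l hil).2.2.trans (hpow l))
      refine mul_le_mul_of_nonneg_left ?_ (hC0 _)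
      rw [pow_mul]
      exact Circle.dist_pow_one_le _ _
    have hgt : ∀ l i, l < i → |d l i| ≤ (1 / 2) ^ i := fun l i hil => by
      refine ((hd l i).trans ?_).trans ((hr l i hil).2.1.trans (hpow i))
      refine mul_le_mul_of_nonneg_left ?_ (hC0 _)
      rw [mul_comm, pow_mul]
      exact Circle.dist_pow_one_le _ _
    have heq : ∀ l, d l l = -1 := fun l => by
      simp only [d]
      rw [← pow_mul, circleTent_eq_zero (hC1 _) (hP l).2.2.2, one_pow, circleTent_one, zero_sub]
    have hsum : Summable fun i : ℕ => (1 / 2 : ℝ) ^ i := summable_geometric_two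
    -- Adding 1 at `i = l` cancels the diagonal increment `-1`; what remains is dominated and tends
    -- to 0 termwise.
    have hbound : ∀ l i, ‖d l i + Pi.single (M := fun _ => ℝ) l 1 i‖ ≤ (1 / 2 : ℝ) ^ i := by
      intro l i
      rcases lt_trichotomy i l with h | rfl | h
      · rw [Pi.single_eq_of_ne h.ne, add_zero]
        exact (hlt l i h).trans (pow_le_pow_of_le_one (by norm_num) (by norm_num) h.le)
      · simp [heq]
      · rw [Pi.single_eq_of_ne h.ne', add_zero]
        exact hgt l i h
    have hlim : Tendsto (fun l => ∑' i, (d l i + Pi.single (M := fun _ => ℝ) l 1 i)) atTop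
        (𝓝 (∑' _ : ℕ, (0 : ℝ))) := by
      refine tendsto_tsum_of_dominated_convergence hsum (fun i => ?_)
        (Eventually.of_forall fun l i => hbound l i)
      refine squeeze_zero_norm' ?_ hhalf
      filter_upwards [eventually_gt_atTop i] with l hl
      rw [Pi.single_eq_of_ne hl.ne, add_zero]
      exact hlt l i hl
    have htsum : ∀ l, ∑' i, d l i = ∑' i, (d l i + Pi.single (M := fun _ => ℝ) l 1 i) + -1 := by
      intro l
      have h1 : HasSum (Pi.single (M := fun _ => ℝ) l 1) 1 := hasSum_pi_single l 1
      have h2 : Summable fun i => d l i + Pi.single (M := fun _ => ℝ) l 1 i :=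
        Summable.of_norm_bounded hsum (hbound l)
      have h3 := (h2.hasSum.sub h1).tsum_eq
      simpa [sub_eq_add_neg] using h3
    rw [tsum_zero] at hlim
    have := hlim.add_const (-1)
    rw [zero_add] at this
    exact this.congr fun l => (htsum l).symm

end Spikes

/-! ### The Furstenberg–Kodaka cocycle -/

section Construction

variable {a : Circle}

/-- Equality would make π rational. -/
theorem Circle.exp_neg_one_zpow_ne_one {k : ℤ} (hk : k ≠ 0) : Circle.exp (-1) ^ k ≠ 1 := by
  rw [← Circle.exp_zsmul, Ne, Circle.exp_eq_one]
  rintro ⟨n, hn⟩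
  rw [zsmul_eq_mul, mul_neg_one] at hn
  have hn0 : n ≠ 0 := by
    rintro rfl
    simp at hn
    exact hk hn
  refine irrational_pi ⟨-k / (2 * n), ?_⟩
  push_cast
  rw [div_eq_iff (by simpa using hn0), hn]
  ring

/-- The pushforward of Haar measure to the graph of a multiple of a measurable transfer function is
invariant, so that a measurable coboundary gives a skew product that is not uniquely ergodic. -/
theorem not_isUniquelyErgodic_skewProduct {t : C(Circle, Circle)} {g : Circle → Circle}
    (hg : Measurable g) (h : ∀ᵐ x ∂circleHaar, g (a * x) = t x * g x) :
    ¬ IsUniquelyErgodic (skewProduct a t) := by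
  let s : Circle → Circle → Circle × Circle := fun c x => (x, c * g x)
  have hs : ∀ c, Measurable (s c) := fun c => measurable_id.prodMk (hg.const_mul c)
  have hinv : ∀ c, circleHaar.map (s c) ∈ invariantMeasures (skewProduct a t) := by
    intro c
    have hprob : IsProbabilityMeasure (circleHaar.map (s c)) :=
      Measure.isProbabilityMeasure_map (hs c).aemeasurable
    have hT : Measurable (skewProduct a t) := (skewProduct a t).continuous.measurable
    refine ⟨hprob, inferInstance, hT, ?_⟩
    have hmul := measurePreserving_mul_left circleHaar a
    rw [Measure.map_map hT (hs c)]
    have hae : skewProduct a t ∘ s c =ᵐ[circleHaar] s c ∘ fun x => a * x := by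
      filter_upwards [h] with x hx
      change (a * x, t x * (c * g x)) = (a * x, c * g (a * x))
      rw [hx, mul_left_comm]
    rw [Measure.map_congr hae, ← Measure.map_map (hs c) hmul.measurable, hmul.map_eq]
  intro hue
  -- The graph of `g` has measure 1 for `c = 1` and measure 0 for `c = -1`.
  have heq := hue.unique (hinv 1) (hinv (-1))
  have hA : MeasurableSet {p : Circle × Circle | p.2 = g p.1} :=
    measurableSet_eq_fun measurable_snd (hg.comp measurable_fst)
  have h1 := congrArg (fun μ : Measure (Circle × Circle) => μ {p | p.2 = g p.1}) heq
  simp only [Measure.map_apply (hs _) hA] at h1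
  have h2 : s 1 ⁻¹' {p : Circle × Circle | p.2 = g p.1} = Set.univ := by
    ext x; simp [s]
  have h3 : s (-1) ⁻¹' {p : Circle × Circle | p.2 = g p.1} = ∅ := by
    refine Set.eq_empty_of_forall_notMem fun x hx => Circle.neg_one_ne_one ?_
    exact mul_eq_right.1 (hx : -1 * g x = g x)
  rw [h2, h3] at h1
  simp at h1

theorem exists_kodaka_cocycle (ha : DenseRange (fun n : ℤ => a ^ n)) :
    ∃ t : C(Circle, Circle), IsKodakaCocycle a t ∧ IsMinimalSystem (skewProduct a t) ∧
      IsDistalSystem (skewProduct a t) ∧ ¬ IsUniquelyErgodic (skewProduct a t) := by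
  obtain ⟨G, N, hG0, hGint, hGinv, hN, hlim⟩ := exists_almost_invariant_spikes ha
  have hsummable : ∀ x, Summable fun i => G i (a * x) - G i x := fun x =>
    Summable.of_norm_bounded summable_geometric_two fun i => hGinv i x
  let h : C(Circle, ℝ) := ⟨fun x => ∑' i, (G i (a * x) - G i x),
    continuous_tsum (fun i => by fun_prop) summable_geometric_two fun i x => hGinv i x⟩
  let t : C(Circle, Circle) := Circle.exp.comp h
  -- Orbit sums of `h` telescope spike by spike, even where `∑ G i` itself may diverge.
  have hsum : ∀ m : ℕ, HasSum (fun i => G i (a ^ m) - G i 1)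
      (∑ j ∈ Finset.range m, h (a ^ j)) := by
    intro m
    induction m with
    | zero => simp
    | succ m ih =>
      rw [Finset.sum_range_succ]
      refine (ih.add (hsummable (a ^ m)).hasSum).congr_fun ?_
      intro i
      rw [← pow_succ']
      ring
  have hcore : ∀ k : ℤ, k ≠ 0 → ∀ f : C(Circle, Circle), ¬ ∀ x, f (a * x) = t x ^ k * f x := by
    intro k hk f hf
    have hiter : ∀ m : ℕ, f (a ^ m) =
        Circle.exp (∑ j ∈ Finset.range m, h (a ^ j)) ^ k * f 1 := by
      intro m
      induction m with
      | zero => simp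
      | succ m ih =>
        rw [Finset.sum_range_succ, pow_succ', hf, ih, Circle.exp_add, mul_zpow, ← mul_assoc,
          mul_comm (t (a ^ m) ^ k)]
        rfl
    have h1 : Tendsto (fun l => f (a ^ N l)) atTop (𝓝 (f 1)) := (f.continuous.tendsto 1).comp hN
    have h2 : Tendsto (fun l => Circle.exp (∑' i, (G i (a ^ N l) - G i 1)) ^ k * f 1) atTop
        (𝓝 (Circle.exp (-1) ^ k * f 1)) :=
      (((Circle.exp.continuous.tendsto _).comp hlim).zpow k).mul_const _
    have h3 := tendsto_nhds_unique h1 (h2.congr fun l => by rw [hiter, (hsum (N l)).tsum_eq])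
    exact Circle.exp_neg_one_zpow_ne_one hk (mul_eq_right.1 h3.symm)
  let E : Circle → ENNReal := fun x => ∑' i, ENNReal.ofReal (G i x)
  have hE : Measurable E := Measurable.tsum fun i =>
    (G i).continuous.measurable.ennreal_ofReal
  have hEfin : ∀ᵐ x ∂circleHaar, E x < ⊤ := by
    refine ae_lt_top hE ?_
    rw [lintegral_tsum fun i => (G i).continuous.measurable.ennreal_ofReal.aemeasurable]
    refine ((ENNReal.tsum_le_tsum hGint).trans_lt ?_).ne
    rw [ENNReal.tsum_geometric]
    simp
  let g : Circle → Circle := fun x => Circle.exp (E x).toReal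
  have hg : Measurable g := Circle.exp.continuous.measurable.comp hE.ennreal_toReal
  have hEsum : ∀ x, E x < ⊤ → HasSum (fun i => G i x) (E x).toReal := by
    intro x hx
    have h1 := ENNReal.hasSum_toReal hx.ne
    rw [← ENNReal.tsum_toReal_eq fun i => ENNReal.ofReal_ne_top] at h1
    simpa only [ENNReal.toReal_ofReal (hG0 _ x)] using h1
  have hgt : ∀ᵐ x ∂circleHaar, g (a * x) = t x * g x := by
    filter_upwards [hEfin,
      (measurePreserving_mul_left circleHaar a).quasiMeasurePreserving.ae hEfin] with x h1 h2
    have h3 : h x = (E (a * x)).toReal - (E x).toReal := ((hEsum _ h2).sub (hEsum _ h1)).tsum_eq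
    change Circle.exp _ = Circle.exp (h x) * Circle.exp _
    rw [← Circle.exp_add, h3, sub_add_cancel]
  refine ⟨t, ⟨g, hg, ?_, ?_⟩, isMinimalSystem_skewProduct ha hcore, isDistalSystem_skewProduct a t,
    not_isUniquelyErgodic_skewProduct hg hgt⟩
  · rw [ae_haar_iff_ae_circleHaar]
    filter_upwards [hgt] with x hx
    rw [hx, mul_div_cancel_right]
  · intro k hk f hf
    rw [ae_haar_iff_ae_circleHaar] at hf
    refine hcore k hk f fun x => ?_
    -- Both sides are continuous and Haar measure has full support, so almost everywhere equality
    -- becomes equality, which `hcore` excludes.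
    have hae : (fun x => f (a * x)) =ᵐ[circleHaar] fun x => t x ^ k * f x := by
      filter_upwards [hgt, hf,
        (measurePreserving_mul_left circleHaar a).quasiMeasurePreserving.ae hf] with x h1 h2 h3
      rw [← h2, ← h3, h1, mul_zpow]
    exact congrFun ((Continuous.ae_eq_iff_eq circleHaar (by fun_prop)
      ((t.continuous.zpow k).mul f.continuous)).1 hae) x

end Construction

theorem mainTheorem9 (α : ℝ) (hα : Irrational α) (a : Circle)
    (ha : a = Circle.exp (2 * Real.pi * α)) :
    (∃ t : C(Circle, Circle), IsKodakaCocycle a t ∧ IsMinimalSystem (skewProduct a t) ∧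
        IsDistalSystem (skewProduct a t) ∧ ¬ IsUniquelyErgodic (skewProduct a t)) ∧
      ∀ t : C(Circle, Circle), IsMinimalSystem (skewProduct a t) →
        ¬ IsUniquelyErgodic (skewProduct a t) →
          IsMaximalEquicontinuousFactor.{0, 0, w} (skewProduct a t) (circleRotation a)
            Prod.fst := by
  have hd : DenseRange (fun n : ℤ => a ^ n) := by
    rw [ha]
    exact Circle.denseRange_zpow_of_irrational hα
  exact ⟨exists_kodaka_cocycle hd, fun t hT hE => isMaximalEquicontinuousFactor_skewProduct hd hT hE⟩
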